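/- Let $N \ge 1$ and let $\Omega \subset \mathbb{R}^N$ be a smooth bounded connected open set. For a Borel function $V : \Omega \to [0,+\infty]$ and $f \in L^2(\Omega)$, let $\zeta_f$ denote the unique minimizer of $$E(z) = \frac12 \int_\Omega \bigl(|\nabla z|^2 + V z^2\bigr)\,dx - \int_\Omega f z\,dx$$ over $W_0^{1,2}(\Omega) \cap L^2(\Omega; V\,dx)$. For $v \in L^1(\Omega)$, the precise representative $\widehat v$ is defined at a point $x$ by $\widehat v(x) = c$ whenever $\lim_{r \to 0} \frac{1}{|B_r(x)|}\int_{B_r(x)} |v - c| = 0$; when $f \in L^\infty(\Omega)$, $\widehat{\zeta_f}$ is defined at every point of $\Omega$. Given a finite Borel measure $\mu$ in $\Omega$, a function $u \in L^1(\Omega)$ is a duality solution of $-\Delta u + V u = \mu$ in $\Omega$, $u = 0$ on $\partial\Omega$, if $$\int_\Omega u f\,dx = \int_\Omega \widehat{\zeta_f}\,d\mu \quad \text{for every } f \in L^\infty(\Omega).$$ There exists a bounded continuous nondecreasing function $H : [0,+\infty) \to [0,+\infty)$, with $H(t) > 0$ for $t > 0$, such that for every Borel function $V : \Omega \to [0,+\infty]$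 and every nonnegative finite Borel measure $\mu$ in $\Omega$, if $u \in L^1(\Omega)$ is a duality solution of $-\Delta u + V u = \mu$ in $\Omega$, $u = 0$ on $\partial\Omega$, then $u \ge 0$ almost everywhere in $\Omega$ and $$u \ge \zeta_{H(u)} \quad \text{almost everywhere in } \Omega.$$ In particular $H$ does not depend on $V$, $\mu$ or $u$. Moreover, for every $\alpha > 1$ there is a constant $c > 0$, depending only on $\Omega$ and $\alpha$, such that one may take $H(t) = c \min\{t^\alpha, 1\}$. -/

import Mathlib

open MeasureTheory Set Filter Topology
open scoped ENNReal NNReal ContDiff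

/-- A smooth bounded connected open set: near each boundary point, `Ω` is the sublevel set
`{ψ < 0}` of a smooth function `ψ` with nonvanishing derivative. -/
structure IsSmoothBoundedDomain {N : ℕ} (Ω : Set (EuclideanSpace ℝ (Fin N))) : Prop where
  isOpen : IsOpen Ω
  isConnected : IsConnected Ω
  isBounded : Bornology.IsBounded Ω
  smooth_boundary : ∀ x ∈ frontier Ω, ∃ U : Set (EuclideanSpace ℝ (Fin N)),
    IsOpen U ∧ x ∈ U ∧ ∃ ψ : EuclideanSpace ℝ (Fin N) → ℝ,
      ContDiffOn ℝ ∞ ψ U ∧ fderiv ℝ ψ x ≠ 0 ∧ Ω ∩ U = {y ∈ U | ψ y < 0}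

/-- The class `C_c^∞(Ω)`. -/
def IsTestFunction {N : ℕ} (Ω : Set (EuclideanSpace ℝ (Fin N)))
    (φ : EuclideanSpace ℝ (Fin N) → ℝ) : Prop :=
  ContDiff ℝ ∞ φ ∧ HasCompactSupport φ ∧ tsupport φ ⊆ Ω

/-- `u ∈ W^{1,2}(Ω)` with weak gradient `g`. Functions on `Ω` are represented by functions on the
whole space, whose values outside `Ω` play no role. -/
structure MemW12 {N : ℕ} (Ω : Set (EuclideanSpace ℝ (Fin N)))
    (u : EuclideanSpace ℝ (Fin N) → ℝ)
    (g : EuclideanSpace ℝ (Fin N) → EuclideanSpace ℝ (Fin N)) : Prop where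
  memLp : MemLp u 2 (volume.restrict Ω)
  memLp_grad : MemLp g 2 (volume.restrict Ω)
  weak_grad : ∀ φ : EuclideanSpace ℝ (Fin N) → ℝ, IsTestFunction Ω φ →
    ∀ v : EuclideanSpace ℝ (Fin N),
      ∫ x in Ω, u x * fderiv ℝ φ x v = - ∫ x in Ω, inner ℝ (g x) v * φ x

/-- `u ∈ W_0^{1,2}(Ω)` with weak gradient `g`: the closure of `C_c^∞(Ω)` in `W^{1,2}(Ω)`. -/
structure MemW12Zero {N : ℕ} (Ω : Set (EuclideanSpace ℝ (Fin N)))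
    (u : EuclideanSpace ℝ (Fin N) → ℝ)
    (g : EuclideanSpace ℝ (Fin N) → EuclideanSpace ℝ (Fin N)) : Prop extends MemW12 Ω u g where
  approx : ∃ φ : ℕ → EuclideanSpace ℝ (Fin N) → ℝ, (∀ n, IsTestFunction Ω (φ n)) ∧
    Tendsto (fun n => eLpNorm (fun x => φ n x - u x) 2 (volume.restrict Ω)) atTop (𝓝 0) ∧
    Tendsto (fun n => eLpNorm (fun x => gradient (φ n) x - g x) 2 (volume.restrict Ω))
      atTop (𝓝 0)

/-- The measure `V dx` on `Ω`. -/
noncomputable def potentialMeasure {N : ℕ} (Ω : Set (EuclideanSpace ℝ (Fin N)))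
    (V : EuclideanSpace ℝ (Fin N) → ℝ≥0∞) : Measure (EuclideanSpace ℝ (Fin N)) :=
  (volume.restrict Ω).withDensity V

/-- `z ∈ W_0^{1,2}(Ω) ∩ L²(Ω; V dx)` with weak gradient `g`. -/
def IsAdmissible {N : ℕ} (Ω : Set (EuclideanSpace ℝ (Fin N)))
    (V : EuclideanSpace ℝ (Fin N) → ℝ≥0∞) (z : EuclideanSpace ℝ (Fin N) → ℝ)
    (g : EuclideanSpace ℝ (Fin N) → EuclideanSpace ℝ (Fin N)) : Prop :=
  MemW12Zero Ω z g ∧ MemLp z 2 (potentialMeasure Ω V)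

/-- The energy `½ ∫_Ω (|∇z|² + V z²) - ∫_Ω f z`, where `g = ∇z`. -/
noncomputable def energy {N : ℕ} (Ω : Set (EuclideanSpace ℝ (Fin N)))
    (V : EuclideanSpace ℝ (Fin N) → ℝ≥0∞) (f z : EuclideanSpace ℝ (Fin N) → ℝ)
    (g : EuclideanSpace ℝ (Fin N) → EuclideanSpace ℝ (Fin N)) : ℝ :=
  1 / 2 * ((∫ x in Ω, ‖g x‖ ^ 2) + (∫ x, z x ^ 2 ∂(potentialMeasure Ω V))) -
    (∫ x in Ω, f x * z x)

/-- `z` minimizes the energy with datum `f` over `W_0^{1,2}(Ω) ∩ L²(Ω; V dx)`. -/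
def IsEnergyMinimizer {N : ℕ} (Ω : Set (EuclideanSpace ℝ (Fin N)))
    (V : EuclideanSpace ℝ (Fin N) → ℝ≥0∞) (f z : EuclideanSpace ℝ (Fin N) → ℝ) : Prop :=
  ∃ g, IsAdmissible Ω V z g ∧
    ∀ w h, IsAdmissible Ω V w h → energy Ω V f z g ≤ energy Ω V f w h

open Classical in
/-- The energy minimizer `ζ_f`. -/
noncomputable def zeta {N : ℕ} (Ω : Set (EuclideanSpace ℝ (Fin N)))
    (V : EuclideanSpace ℝ (Fin N) → ℝ≥0∞) (f : EuclideanSpace ℝ (Fin N) → ℝ) :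
    EuclideanSpace ℝ (Fin N) → ℝ :=
  if h : ∃ z, IsEnergyMinimizer Ω V f z then h.choose else 0

/-- `x` is a Lebesgue point of `v` with value `c`: the average of `|v - c|` over
`B_r(x)` tends to `0` as `r → 0`. -/
def HasLebesgueValue {N : ℕ} (v : EuclideanSpace ℝ (Fin N) → ℝ)
    (x : EuclideanSpace ℝ (Fin N)) (c : ℝ) : Prop :=
  Tendsto (fun r : ℝ => laverage (volume.restrict (Metric.ball x r)) fun y => ‖v y - c‖ₑ) (𝓝[>] 0) (𝓝 0)

open Classical in
/-- The precise representative of `v` (set to `0` off the Lebesgue points). -/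
noncomputable def preciseRep {N : ℕ} (v : EuclideanSpace ℝ (Fin N) → ℝ)
    (x : EuclideanSpace ℝ (Fin N)) : ℝ :=
  if h : ∃ c, HasLebesgueValue v x c then h.choose else 0

/-- `u ∈ L¹(Ω)` is a duality solution of `-Δu + Vu = μ` in `Ω`, `u = 0` on `∂Ω`, for a nonnegative
measure `μ` (only the restriction of `μ` to `Ω` matters). -/
def IsDualitySolution {N : ℕ} (Ω : Set (EuclideanSpace ℝ (Fin N)))
    (V : EuclideanSpace ℝ (Fin N) → ℝ≥0∞) (μ : Measure (EuclideanSpace ℝ (Fin N)))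
    (u : EuclideanSpace ℝ (Fin N) → ℝ) : Prop :=
  IntegrableOn u Ω ∧
    ∀ f : EuclideanSpace ℝ (Fin N) → ℝ, MemLp f ∞ (volume.restrict Ω) →
      ∫ x in Ω, u x * f x = ∫ x in Ω, preciseRep (zeta Ω V f) x ∂μ

/-- The function `H(u)` for `H : [0,∞) → [0,∞)` and a nonnegative function `u`. -/
noncomputable def compNonneg {N : ℕ} (H : ℝ≥0 → ℝ≥0) (u : EuclideanSpace ℝ (Fin N) → ℝ)
    (x : EuclideanSpace ℝ (Fin N)) : ℝ :=
  (H (u x).toNNReal : ℝ)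

/-- For every Borel potential `V`, every duality solution `u` with nonnegative finite measure datum
satisfies `u ≥ ζ_{H(u)}` almost everywhere in `Ω`. The first two conjuncts record that `H(u)` and
`ζ_{H(u)}` are meaningful: `u ≥ 0` almost everywhere, and the minimizer exists. -/
def ComparisonHolds {N : ℕ} (Ω : Set (EuclideanSpace ℝ (Fin N))) (H : ℝ≥0 → ℝ≥0) : Prop :=
  ∀ V : EuclideanSpace ℝ (Fin N) → ℝ≥0∞, Measurable V →
    ∀ μ : Measure (EuclideanSpace ℝ (Fin N)), IsFiniteMeasure μ →
      ∀ u : EuclideanSpace ℝ (Fin N) → ℝ, IsDualitySolution Ω V μ u →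
        (∀ᵐ x ∂(volume.restrict Ω), 0 ≤ u x) ∧
        IsEnergyMinimizer Ω V (compNonneg H u) (zeta Ω V (compNonneg H u)) ∧
        ∀ᵐ x ∂(volume.restrict Ω), zeta Ω V (compNonneg H u) x ≤ u x

/-! Write `G f` for the weak solution of `-Δz + Vz = f` in `W_0^{1,2}(Ω) ∩ L²(Ω; V dx)`; it agrees
almost everywhere with `ζ_f`. The only information kept from the equation for `u` is a sign: since
`μ ≥ 0`, one has `∫ u f ≥ 0` for every bounded `f` with `G f ≥ 0` (`IsDualSupersolution`). The rest
relies on two properties of `G`: it is symmetric, and `G f ≤ C M` whenever `f ≤ M`, with `M ≥ 0` and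
`C` independent of `V` (`exists_weakSolution_bound`).

The core is a weak-type estimate: `s ∫_A G h ≤ C ∫ u h` for bounded `h ≥ 0` and `A = {u ≥ s}`. To
prove it, add the potential `t 1_A` and let `z_t` be the solution with datum `h`. It solves the
original equation with datum `h - t 1_A z_t`, so testing against `u` gives `s t ∫_A z_t ≤ ∫ u h`.
Moreover `G h - z_t = G(t 1_A z_t)`, and by symmetry the integral of this function over `A` is `t
∫_A z_t G(1_A) ≤ C t ∫_A z_t`. Letting `t → ∞` removes `∫_A z_t`.

Integrating over the levels `s` gives `∫ min(u,1)^p G h ≤ (p/(p-1)) C ∫ u h` for `p > 1`. By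
symmetry, `w = G(c min(u,1)^p)` with `c = (p-1)/(pC)` satisfies `∫ w h ≤ ∫ u h` for all such `h`,
hence `w ≤ u`. The constant depends only on `Ω` and `p`. -/

/-! ### Convergence and inner products in `L²`. -/

section L2Convergence

/-- Dominated convergence in `L²`. -/
lemma tendsto_eLpNorm_two_of_dominated {α F : Type*} {m : MeasurableSpace α} {ν : Measure α}
    [NormedAddCommGroup F] {a : ℕ → α → F} {b : α → ℝ}
    (ha : ∀ n, AEStronglyMeasurable (a n) ν) (hb : MemLp b 2 ν)
    (hab : ∀ n, ∀ᵐ x ∂ν, ‖a n x‖ ≤ b x) (h0 : ∀ᵐ x ∂ν, Tendsto (fun n => a n x) atTop (𝓝 0)) :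
    Tendsto (fun n => eLpNorm (a n) 2 ν) atTop (𝓝 0) := by
  have key : Tendsto (fun n => ∫⁻ x, ‖a n x‖ₑ ^ (2 : ℝ) ∂ν) atTop (𝓝 (∫⁻ x, 0 ∂ν)) := by
    refine tendsto_lintegral_of_dominated_convergence' (fun x => ‖b x‖ₑ ^ (2 : ℝ))
      (fun n => (ha n).enorm.pow_const _) ?_ ?_ ?_
    · intro n
      filter_upwards [hab n] with x hx
      gcongr
      exact enorm_le_iff_norm_le.2 (hx.trans (le_abs_self _))
    · have := hb.2
      rw [eLpNorm_lt_top_iff_lintegral_rpow_enorm_lt_top (by norm_num) (by norm_num)] at this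
      simpa using this.ne
    · filter_upwards [h0] with x hx
      have := (ENNReal.continuous_rpow_const (y := 2)).tendsto _ |>.comp hx.enorm
      simpa [Function.comp_def] using this
  simp only [lintegral_zero] at key
  have h2 := (ENNReal.continuous_rpow_const (y := 1 / 2)).tendsto _ |>.comp key
  simp only [ENNReal.zero_rpow_of_pos (show (0 : ℝ) < 1 / 2 by norm_num)] at h2
  refine h2.congr fun n => ?_
  rw [eLpNorm_eq_lintegral_rpow_enorm_toReal (by norm_num) (by norm_num)]
  simp

variable {α F : Type*} {m : MeasurableSpace α} {ν : Measure α}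
  [NormedAddCommGroup F] [InnerProductSpace ℝ F]

lemma inner_toLp_toLp {c d : α → F} (hc : MemLp c 2 ν) (hd : MemLp d 2 ν) :
    inner ℝ (hc.toLp c) (hd.toLp d) = ∫ x, inner ℝ (c x) (d x) ∂ν := by
  rw [L2.inner_def]
  refine integral_congr_ae ?_
  filter_upwards [hc.coeFn_toLp, hd.coeFn_toLp] with x h1 h2
  rw [h1, h2]

/-- The integral of the inner product is continuous for convergence in `L²`. -/
lemma tendsto_integral_inner_of_tendsto_eLpNorm {a b : ℕ → α → F} {a' b' : α → F}
    (ha : ∀ n, MemLp (a n) 2 ν) (ha' : MemLp a' 2 ν)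
    (hat : Tendsto (fun n => eLpNorm (fun x => a n x - a' x) 2 ν) atTop (𝓝 0))
    (hb : ∀ n, MemLp (b n) 2 ν) (hb' : MemLp b' 2 ν)
    (hbt : Tendsto (fun n => eLpNorm (fun x => b n x - b' x) 2 ν) atTop (𝓝 0)) :
    Tendsto (fun n => ∫ x, inner ℝ (a n x) (b n x) ∂ν) atTop (𝓝 (∫ x, inner ℝ (a' x) (b' x) ∂ν)) := by
  have h1 := (Lp.tendsto_Lp_iff_tendsto_eLpNorm'' a ha a' ha').2 hat
  have h2 := (Lp.tendsto_Lp_iff_tendsto_eLpNorm'' b hb b' hb').2 hbt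
  simpa only [inner_toLp_toLp] using h1.inner (𝕜 := ℝ) h2

lemma integrable_inner_of_memLp {c d : α → F} (hc : MemLp c 2 ν) (hd : MemLp d 2 ν) :
    Integrable (fun x => inner ℝ (c x) (d x)) ν := by
  refine (L2.integrable_inner (𝕜 := ℝ) (hc.toLp c) (hd.toLp d)).congr ?_
  filter_upwards [hc.coeFn_toLp, hd.coeFn_toLp] with x h1 h2
  rw [h1, h2]

lemma integrable_mul_of_memLp {c d : α → ℝ} (hc : MemLp c 2 ν) (hd : MemLp d 2 ν) :
    Integrable (fun x => c x * d x) ν := by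
  simpa [mul_comm] using integrable_inner_of_memLp hd hc

end L2Convergence

/-! ### Test functions, `W_0^{1,2}(Ω)` as a closed subspace, and the Poincaré inequality. -/

section TestFunctions

variable {N : ℕ} {Ω : Set (EuclideanSpace ℝ (Fin N))}

lemma continuous_gradient {φ : EuclideanSpace ℝ (Fin N) → ℝ} (h : ContDiff ℝ ∞ φ) :
    Continuous (gradient φ) :=
  (InnerProductSpace.toDual ℝ _).symm.continuous.comp (h.continuous_fderiv (by simp))

lemma Continuous.memLp_restrict_of_isBounded {F : Type*} [NormedAddCommGroup F]
    [SecondCountableTopology F]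
    (hΩ : Bornology.IsBounded Ω) {a : EuclideanSpace ℝ (Fin N) → F} (ha : Continuous a)
    (p : ℝ≥0∞) : MemLp a p (volume.restrict Ω) := by
  have hc : IsCompact (closure Ω) := hΩ.isCompact_closure
  obtain ⟨C, hC⟩ := hc.exists_bound_of_continuousOn ha.continuousOn
  borelize F
  have : IsFiniteMeasure (volume.restrict (closure Ω)) := ⟨by simpa using hc.measure_lt_top⟩
  have h1 : MemLp a p (volume.restrict (closure Ω)) := by
    refine MemLp.of_bound ha.aestronglyMeasurable C ?_
    exact (ae_restrict_iff' isClosed_closure.measurableSet).2 (Eventually.of_forall hC)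
  exact h1.mono_measure (Measure.restrict_mono subset_closure le_rfl)

namespace IsTestFunction

variable {φ χ : EuclideanSpace ℝ (Fin N) → ℝ}

lemma zero : IsTestFunction Ω (fun _ => 0) :=
  ⟨contDiff_const, HasCompactSupport.zero, by simp [tsupport]⟩

lemma add (hφ : IsTestFunction Ω φ) (hχ : IsTestFunction Ω χ) :
    IsTestFunction Ω (fun x => φ x + χ x) :=
  ⟨hφ.1.add hχ.1, hφ.2.1.add hχ.2.1, (tsupport_add φ χ).trans (union_subset hφ.2.2 hχ.2.2)⟩

/-- A smooth function that vanishes wherever the test function `φ` does is a test function. -/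
lemma of_eq_zero (hφ : IsTestFunction Ω φ) (hχ : ContDiff ℝ ∞ χ) (h : ∀ x, φ x = 0 → χ x = 0) :
    IsTestFunction Ω χ := by
  have hs : tsupport χ ⊆ tsupport φ := closure_mono fun x hx hx' => hx (h x hx')
  exact ⟨hχ, hφ.2.1.mono' (subset_closure.trans hs), hs.trans hφ.2.2⟩

lemma const_mul (hφ : IsTestFunction Ω φ) (c : ℝ) : IsTestFunction Ω (fun x => c * φ x) :=
  hφ.of_eq_zero (contDiff_const.mul hφ.1) fun x hx => by simp [hx]

lemma continuous (hφ : IsTestFunction Ω φ) : Continuous φ := hφ.1.continuous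

lemma differentiable (hφ : IsTestFunction Ω φ) : Differentiable ℝ φ := hφ.1.differentiable (by simp)

lemma memLp (hφ : IsTestFunction Ω φ) (p : ℝ≥0∞) : MemLp φ p (volume.restrict Ω) :=
  (hφ.continuous.memLp_of_hasCompactSupport hφ.2.1).restrict _

lemma memLp_gradient (hφ : IsTestFunction Ω φ) (p : ℝ≥0∞) :
    MemLp (gradient φ) p (volume.restrict Ω) := by
  refine ((continuous_gradient hφ.1).memLp_of_hasCompactSupport ?_).restrict _
  exact (hφ.2.1.fderiv ℝ).comp_left (map_zero _)

lemma eq_zero_of_notMem (hφ : IsTestFunction Ω φ) {x : EuclideanSpace ℝ (Fin N)} (hx : x ∉ Ω) :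
    φ x = 0 := image_eq_zero_of_notMem_tsupport fun h => hx (hφ.2.2 h)

lemma fderiv_eq_zero_of_notMem (hφ : IsTestFunction Ω φ) {x : EuclideanSpace ℝ (Fin N)}
    (hx : x ∉ Ω) : fderiv ℝ φ x = 0 :=
  image_eq_zero_of_notMem_tsupport fun h => hx (hφ.2.2 (tsupport_fderiv_subset ℝ h))

/-- Integration by parts against a smooth function. -/
lemma integral_mul_fderiv (hφ : IsTestFunction Ω φ) {ρ : EuclideanSpace ℝ (Fin N) → ℝ}
    (hρ : ContDiff ℝ ∞ ρ) (v : EuclideanSpace ℝ (Fin N)) :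
    ∫ x in Ω, ρ x * fderiv ℝ φ x v = - ∫ x in Ω, fderiv ℝ ρ x v * φ x := by
  rw [setIntegral_eq_integral_of_forall_compl_eq_zero, setIntegral_eq_integral_of_forall_compl_eq_zero]
  · have hc : Continuous fun x => fderiv ℝ φ x v := (hφ.1.continuous_fderiv (by simp)).clm_apply continuous_const
    have hc' : Continuous fun x => fderiv ℝ ρ x v := (hρ.continuous_fderiv (by simp)).clm_apply continuous_const
    refine integral_mul_fderiv_eq_neg_fderiv_mul_of_integrable ?_ ?_ ?_ ?_ ?_
    · exact (hc'.mul hφ.continuous).integrable_of_hasCompactSupport hφ.2.1.mul_left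
    · refine (hρ.continuous.mul hc).integrable_of_hasCompactSupport (HasCompactSupport.mul_left ?_)
      exact (hφ.2.1.fderiv ℝ).comp_left (g := fun L => L v) (by simp)
    · exact (hρ.continuous.mul hφ.continuous).integrable_of_hasCompactSupport hφ.2.1.mul_left
    · intro x _; exact hρ.differentiable (by simp) x
    · intro x _; exact hφ.differentiable x
  · intro x hx; simp [hφ.eq_zero_of_notMem hx]
  · intro x hx; simp [hφ.fderiv_eq_zero_of_notMem hx]

end IsTestFunction

lemma gradient_add' {φ χ : EuclideanSpace ℝ (Fin N) → ℝ} (hφ : Differentiable ℝ φ)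
    (hχ : Differentiable ℝ χ) : gradient (fun x => φ x + χ x) = fun x => gradient φ x + gradient χ x := by
  ext1 x
  simp only [gradient]
  rw [fderiv_fun_add (hφ x) (hχ x), map_add]

lemma gradient_const_mul' {φ : EuclideanSpace ℝ (Fin N) → ℝ} (hφ : Differentiable ℝ φ) (c : ℝ) :
    gradient (fun x => c * φ x) = fun x => c • gradient φ x := by
  ext1 x
  simp only [gradient]
  rw [fderiv_const_mul (hφ x), map_smul]

/-- The pairs `(φ, ∇φ)` with `φ ∈ C_c^∞(Ω)`, as a subspace of `L² × L²`. -/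
noncomputable def testGraph (Ω : Set (EuclideanSpace ℝ (Fin N))) :
    Submodule ℝ (Lp ℝ 2 (volume.restrict Ω) × Lp (EuclideanSpace ℝ (Fin N)) 2 (volume.restrict Ω)) where
  carrier := {p | ∃ φ, ∃ h : IsTestFunction Ω φ,
    p = ((h.memLp 2).toLp φ, (h.memLp_gradient 2).toLp (gradient φ))}
  add_mem' := by
    rintro _ _ ⟨φ, hφ, rfl⟩ ⟨χ, hχ, rfl⟩
    refine ⟨_, hφ.add hχ, ?_⟩
    simp only [gradient_add' hφ.differentiable hχ.differentiable]
    rfl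
  zero_mem' := by
    refine ⟨_, IsTestFunction.zero, ?_⟩
    have : gradient (fun _ : EuclideanSpace ℝ (Fin N) => (0 : ℝ)) = 0 := by
      ext1 x; simp [gradient]
    simp only [this]
    rfl
  smul_mem' := by
    rintro c _ ⟨φ, hφ, rfl⟩
    refine ⟨_, hφ.const_mul c, ?_⟩
    simp only [gradient_const_mul' hφ.differentiable]
    rfl

/-- The space `W_0^{1,2}(Ω)` as a closed subspace of `L² × L²`. -/
noncomputable def sobolevZero (Ω : Set (EuclideanSpace ℝ (Fin N))) :
    Submodule ℝ (Lp ℝ 2 (volume.restrict Ω) × Lp (EuclideanSpace ℝ (Fin N)) 2 (volume.restrict Ω)) :=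
  (testGraph Ω).topologicalClosure

variable {u w : EuclideanSpace ℝ (Fin N) → ℝ}
  {g k : EuclideanSpace ℝ (Fin N) → EuclideanSpace ℝ (Fin N)}

/-- The weak gradient identity follows from approximability by test functions. -/
lemma memW12Zero_of_approx (hu : MemLp u 2 (volume.restrict Ω)) (hg : MemLp g 2 (volume.restrict Ω))
    (h : ∃ φ : ℕ → EuclideanSpace ℝ (Fin N) → ℝ, (∀ n, IsTestFunction Ω (φ n)) ∧
      Tendsto (fun n => eLpNorm (fun x => φ n x - u x) 2 (volume.restrict Ω)) atTop (𝓝 0) ∧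
      Tendsto (fun n => eLpNorm (fun x => gradient (φ n) x - g x) 2 (volume.restrict Ω))
        atTop (𝓝 0)) : MemW12Zero Ω u g := by
  refine ⟨⟨hu, hg, fun χ hχ v => ?_⟩, h⟩
  obtain ⟨φ, hφ, h1, h2⟩ := h
  have hv : MemLp (fun x => fderiv ℝ χ x v) 2 (volume.restrict Ω) := by
    simpa only [inner_gradient_left] using (hχ.memLp_gradient 2).inner_const (𝕜 := ℝ) v
  have hv' : MemLp (fun x => χ x • v) 2 (volume.restrict Ω) := by
    simpa [Function.comp_def] using
      (ContinuousLinearMap.toSpanSingleton ℝ v).comp_memLp' (hχ.memLp 2)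
  have t1 := tendsto_integral_inner_of_tendsto_eLpNorm (fun n => (hφ n).memLp 2) hu h1
    (fun _ => hv) hv (by simp)
  have t2 := tendsto_integral_inner_of_tendsto_eLpNorm (fun n => (hφ n).memLp_gradient 2) hg h2
    (fun _ => hv') hv' (by simp)
  have e : ∀ n, ∫ x in Ω, inner ℝ (φ n x) (fderiv ℝ χ x v)
      = - ∫ x in Ω, inner ℝ (gradient (φ n) x) (χ x • v) := by
    intro n
    simp only [inner_smul_right, inner_gradient_left]
    have := hχ.integral_mul_fderiv (hφ n).1 v
    simpa [mul_comm] using this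
  simp only [e] at t1
  have := tendsto_nhds_unique t1 t2.neg
  simpa [inner_smul_right, mul_comm] using this

/-- Approximation by test functions is sequential closure of their graph, so vector space structure
and completeness come from the closed subspace `sobolevZero`. -/
lemma memW12Zero_iff : MemW12Zero Ω u g ↔ ∃ (hu : MemLp u 2 (volume.restrict Ω))
    (hg : MemLp g 2 (volume.restrict Ω)), (hu.toLp u, hg.toLp g) ∈ sobolevZero Ω := by
  constructor
  · intro h
    refine ⟨h.memLp, h.memLp_grad, ?_⟩
    obtain ⟨φ, hφ, h1, h2⟩ := h.approx
    have t1 := (Lp.tendsto_Lp_iff_tendsto_eLpNorm'' φ (fun n => (hφ n).memLp 2) u h.memLp).2 h1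
    have t2 := (Lp.tendsto_Lp_iff_tendsto_eLpNorm'' (fun n => gradient (φ n))
      (fun n => (hφ n).memLp_gradient 2) g h.memLp_grad).2 h2
    exact mem_closure_of_tendsto (t1.prodMk_nhds t2)
      (Eventually.of_forall fun n => ⟨φ n, hφ n, rfl⟩)
  · rintro ⟨hu, hg, h⟩
    obtain ⟨p, hp, ht⟩ := mem_closure_iff_seq_limit.1 h
    choose φ hφ hpφ using hp
    obtain rfl : p = _ := funext hpφ
    refine memW12Zero_of_approx hu hg ⟨φ, hφ, ?_, ?_⟩
    · exact (Lp.tendsto_Lp_iff_tendsto_eLpNorm'' φ (fun n => (hφ n).memLp 2) u hu).1 ht.fst_nhds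
    · exact (Lp.tendsto_Lp_iff_tendsto_eLpNorm'' (fun n => gradient (φ n))
        (fun n => (hφ n).memLp_gradient 2) g hg).1 ht.snd_nhds

lemma mem_sobolevZero_iff {p : Lp ℝ 2 (volume.restrict Ω) ×
    Lp (EuclideanSpace ℝ (Fin N)) 2 (volume.restrict Ω)} :
    p ∈ sobolevZero Ω ↔ MemW12Zero Ω p.1 p.2 := by
  rw [memW12Zero_iff]
  constructor
  · intro h
    refine ⟨Lp.memLp _, Lp.memLp _, ?_⟩
    simpa using h
  · rintro ⟨_, _, h⟩
    simpa using h

namespace MemW12Zero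

lemma add (h : MemW12Zero Ω u g) (h' : MemW12Zero Ω w k) :
    MemW12Zero Ω (fun x => u x + w x) (fun x => g x + k x) := by
  rw [memW12Zero_iff] at *
  obtain ⟨a, b, c⟩ := h
  obtain ⟨a', b', c'⟩ := h'
  exact ⟨a.add a', b.add b', (sobolevZero Ω).add_mem c c'⟩

lemma const_smul (h : MemW12Zero Ω u g) (t : ℝ) :
    MemW12Zero Ω (fun x => t * u x) (fun x => t • g x) := by
  rw [memW12Zero_iff] at *
  obtain ⟨a, b, c⟩ := h
  exact ⟨a.const_mul t, b.const_smul t, (sobolevZero Ω).smul_mem t c⟩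

lemma sub (h : MemW12Zero Ω u g) (h' : MemW12Zero Ω w k) :
    MemW12Zero Ω (fun x => u x - w x) (fun x => g x - k x) := by
  simpa [sub_eq_add_neg] using h.add (h'.const_smul (-1))

lemma congr (h : MemW12Zero Ω u g) (hu : u =ᵐ[volume.restrict Ω] w)
    (hg : g =ᵐ[volume.restrict Ω] k) : MemW12Zero Ω w k := by
  rw [memW12Zero_iff] at *
  obtain ⟨a, b, c⟩ := h
  refine ⟨a.ae_eq hu, b.ae_eq hg, ?_⟩
  rwa [MemLp.toLp_congr a (a.ae_eq hu) hu, MemLp.toLp_congr b (b.ae_eq hg) hg] at c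

/-- Integration by parts of a `W_0^{1,2}` function against a smooth function. -/
lemma integral_mul_inner (hΩ : Bornology.IsBounded Ω) (h : MemW12Zero Ω u g)
    {ρ : EuclideanSpace ℝ (Fin N) → ℝ} (hρ : ContDiff ℝ ∞ ρ) (v : EuclideanSpace ℝ (Fin N)) :
    ∫ x in Ω, ρ x * inner ℝ (g x) v = - ∫ x in Ω, fderiv ℝ ρ x v * u x := by
  obtain ⟨φ, hφ, h1, h2⟩ := h.approx
  have hv : MemLp (fun x => fderiv ℝ ρ x v) 2 (volume.restrict Ω) :=
    ((hρ.continuous_fderiv (by simp)).clm_apply continuous_const).memLp_restrict_of_isBounded hΩ 2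
  have hv' : MemLp (fun x => ρ x • v) 2 (volume.restrict Ω) :=
    (hρ.continuous.smul continuous_const).memLp_restrict_of_isBounded hΩ 2
  have t1 := tendsto_integral_inner_of_tendsto_eLpNorm (fun n => (hφ n).memLp 2) h.memLp h1
    (fun _ => hv) hv (by simp)
  have t2 := tendsto_integral_inner_of_tendsto_eLpNorm (fun n => (hφ n).memLp_gradient 2)
    h.memLp_grad h2 (fun _ => hv') hv' (by simp)
  have e : ∀ n, ∫ x in Ω, inner ℝ (gradient (φ n) x) (ρ x • v)
      = - ∫ x in Ω, inner ℝ (φ n x) (fderiv ℝ ρ x v) := by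
    intro n
    simp only [inner_smul_right, inner_gradient_left]
    have := (hφ n).integral_mul_fderiv hρ v
    simpa [mul_comm] using this
  simp only [e] at t2
  have := tendsto_nhds_unique t2 t1.neg
  simpa [inner_smul_right, mul_comm] using this

end MemW12Zero

/-- The Poincaré inequality for test functions, by integrating `φ² ∂_i x_i` by parts. -/
lemma IsTestFunction.integral_sq_le {φ : EuclideanSpace ℝ (Fin N) → ℝ} (hφ : IsTestFunction Ω φ)
    (i : Fin N) {R : ℝ} (hR : ∀ x ∈ Ω, |x i| ≤ R) (hΩ : MeasurableSet Ω) :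
    ∫ x in Ω, φ x ^ 2 ≤ 4 * R ^ 2 * ∫ x in Ω, ‖gradient φ x‖ ^ 2 := by
  set v : EuclideanSpace ℝ (Fin N) := EuclideanSpace.single i 1
  have hv : ‖v‖ = 1 := by simp [v]
  let L : EuclideanSpace ℝ (Fin N) →L[ℝ] ℝ := EuclideanSpace.proj i
  have hφ2 : IsTestFunction Ω (fun x => φ x ^ 2) :=
    hφ.of_eq_zero (hφ.1.pow 2) fun x hx => by simp [hx]
  have key := hφ2.integral_mul_fderiv (ρ := L) L.contDiff v
  have hLv : L v = 1 := by simp [L, v]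
  have hd : ∀ x, fderiv ℝ (fun x => φ x ^ 2) x v = 2 * φ x * fderiv ℝ φ x v := by
    intro x
    rw [fderiv_fun_pow 2 (hφ.differentiable x)]
    simp
  simp only [hd, ContinuousLinearMap.fderiv, hLv, one_mul] at key
  have i1 : Integrable (fun x => φ x ^ 2) (volume.restrict Ω) := (hφ.memLp 2).integrable_sq
  have i2 : Integrable (fun x => ‖gradient φ x‖ ^ 2) (volume.restrict Ω) :=
    (hφ.memLp_gradient 2).norm.integrable_sq
  -- Young's inequality applied to `-2 x_i φ ∂_iφ`; the weight `1/2` lets half of `∫ φ²` be absorbed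
  -- on the left, which produces the constant `4 R²`.
  have key2 : ∫ x in Ω, φ x ^ 2 ≤ ∫ x in Ω, (1 / 2 * φ x ^ 2 + 2 * R ^ 2 * ‖gradient φ x‖ ^ 2) := by
    rw [← neg_neg (∫ x in Ω, φ x ^ 2), ← key, ← integral_neg]
    refine integral_mono_ae ?_ ((i1.const_mul _).add (i2.const_mul _)) ?_
    · have : MemLp (fun x => L x * φ x) 2 (volume.restrict Ω) :=
        (hφ.of_eq_zero (L.contDiff.mul hφ.1) fun x hx => by simp [hx]).memLp 2
      refine (integrable_mul_of_memLp this
        ((hφ.memLp_gradient 2).inner_const (𝕜 := ℝ) v)).const_mul (-2) |>.congr ?_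
      refine Eventually.of_forall fun x => ?_
      simp only [inner_gradient_left]
      ring
    · refine (ae_restrict_iff' hΩ).2 (Eventually.of_forall fun x hx => ?_)
      have h1 : |fderiv ℝ φ x v| ≤ ‖gradient φ x‖ := by
        rw [← inner_gradient_left]
        simpa [hv] using abs_real_inner_le_norm (gradient φ x) v
      have h2 : |L x| ≤ R := hR x hx
      have hR0 : 0 ≤ R := (abs_nonneg _).trans h2
      have h3 : (L x * fderiv ℝ φ x v) ^ 2 ≤ R ^ 2 * ‖gradient φ x‖ ^ 2 := by
        rw [← mul_pow, ← sq_abs, abs_mul]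
        gcongr
      nlinarith [sq_nonneg (φ x + 2 * (L x * fderiv ℝ φ x v))]
  rw [integral_add (i1.const_mul _) (i2.const_mul _), integral_const_mul, integral_const_mul] at key2
  linarith

/-- The Poincaré inequality. -/
lemma exists_poincare (hN : 1 ≤ N) (hΩ : MeasurableSet Ω) (hb : Bornology.IsBounded Ω) :
    ∃ C : ℝ, 0 < C ∧ ∀ u g, MemW12Zero Ω u g →
      ∫ x in Ω, u x ^ 2 ≤ C * ∫ x in Ω, ‖g x‖ ^ 2 := by
  obtain ⟨R, hR0, hR⟩ := hb.exists_pos_norm_le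
  refine ⟨4 * R ^ 2, by positivity, fun u g h => ?_⟩
  obtain ⟨φ, hφ, h1, h2⟩ := h.approx
  have t1 := tendsto_integral_inner_of_tendsto_eLpNorm (fun n => (hφ n).memLp 2) h.memLp h1
    (fun n => (hφ n).memLp 2) h.memLp h1
  have t2 := tendsto_integral_inner_of_tendsto_eLpNorm (fun n => (hφ n).memLp_gradient 2)
    h.memLp_grad h2 (fun n => (hφ n).memLp_gradient 2) h.memLp_grad h2
  simp only [real_inner_self_eq_norm_sq] at t1 t2
  simp only [Real.norm_eq_abs, sq_abs] at t1
  refine le_of_tendsto_of_tendsto' t1 (t2.const_mul _) fun n => ?_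
  refine (hφ n).integral_sq_le ⟨0, hN⟩ (fun x hx => ?_) hΩ
  exact (PiLp.norm_apply_le x _).trans (hR x hx)

end TestFunctions

/-! ### Smooth truncation in `W_0^{1,2}(Ω)`. -/

section Truncation

/-- The transition is constant on each side of `[0,1]`, so compactness bounds its derivative. It
serves as a smooth bounded substitute for the positive part in test functions. -/
lemma Real.smoothTransition.exists_deriv_bound :
    ∃ K : ℝ, 0 < K ∧ (∀ t, |deriv Real.smoothTransition t| ≤ K) ∧
      (∀ s t, |Real.smoothTransition s - Real.smoothTransition t| ≤ K * |s - t|) := by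
  have hc : Continuous (deriv Real.smoothTransition) :=
    (Real.smoothTransition.contDiff (n := 1)).continuous_deriv le_rfl
  obtain ⟨K, hK⟩ := (isCompact_Icc (a := (0 : ℝ)) (b := 1)).exists_bound_of_continuousOn hc.continuousOn
  have hK' : ∀ t, |deriv Real.smoothTransition t| ≤ max K 1 := by
    intro t
    by_cases h0 : t < 0
    · have : Real.smoothTransition =ᶠ[𝓝 t] fun _ => 0 := by
        filter_upwards [Iio_mem_nhds h0] with x hx
        exact Real.smoothTransition.zero_of_nonpos (le_of_lt hx)
      simp [this.deriv_eq]
    by_cases h1 : 1 < t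
    · have : Real.smoothTransition =ᶠ[𝓝 t] fun _ => 1 := by
        filter_upwards [Ioi_mem_nhds h1] with x hx
        exact Real.smoothTransition.one_of_one_le (le_of_lt hx)
      simp [this.deriv_eq]
    · exact (hK t ⟨not_lt.1 h0, not_lt.1 h1⟩).trans (le_max_left _ _)
  refine ⟨max K 1, by positivity, hK', fun s t => ?_⟩
  exact Convex.norm_image_sub_le_of_norm_deriv_le (s := univ)
    (fun x _ => (Real.smoothTransition.contDiff (n := 1)).differentiable (by simp) x)
    (fun x _ => hK' x) convex_univ (mem_univ t) (mem_univ s)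

variable {N : ℕ} {Ω : Set (EuclideanSpace ℝ (Fin N))}

lemma gradient_smoothTransition_comp {φ : EuclideanSpace ℝ (Fin N) → ℝ} (hφ : Differentiable ℝ φ)
    (x : EuclideanSpace ℝ (Fin N)) : gradient (fun y => Real.smoothTransition (φ y)) x =
      deriv Real.smoothTransition (φ x) • gradient φ x := by
  have h : HasDerivAt Real.smoothTransition (deriv Real.smoothTransition (φ x)) (φ x) :=
    ((Real.smoothTransition.contDiff (n := 1)).differentiable (by simp) _).hasDerivAt
  have := (h.comp_hasFDerivAt x (hφ x).hasFDerivAt).fderiv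
  simp only [gradient]
  rw [show (fun y => Real.smoothTransition (φ y)) = Real.smoothTransition ∘ φ from rfl, this, map_smul]

/-- Truncation of a `W_0^{1,2}` function from below by a nonnegative smooth function. -/
lemma MemW12Zero.smoothTransition_sub (hb : Bornology.IsBounded Ω)
    {z ψ : EuclideanSpace ℝ (Fin N) → ℝ} {g : EuclideanSpace ℝ (Fin N) → EuclideanSpace ℝ (Fin N)}
    (hz : MemW12Zero Ω z g) (hψ : ContDiff ℝ ∞ ψ) (hψ0 : ∀ x, 0 ≤ ψ x) :
    MemW12Zero Ω (fun x => Real.smoothTransition (z x - ψ x))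
      (fun x => deriv Real.smoothTransition (z x - ψ x) • (g x - gradient ψ x)) := by
  obtain ⟨K, hK0, hK, hKL⟩ := Real.smoothTransition.exists_deriv_bound
  have hTc : Continuous (deriv Real.smoothTransition) :=
    (Real.smoothTransition.contDiff (n := 1)).continuous_deriv le_rfl
  have hzψ : MemLp (fun x => z x - ψ x) 2 (volume.restrict Ω) :=
    hz.memLp.sub (hψ.continuous.memLp_restrict_of_isBounded hb 2)
  have hgψ : MemLp (fun x => g x - gradient ψ x) 2 (volume.restrict Ω) :=
    hz.memLp_grad.sub ((continuous_gradient hψ).memLp_restrict_of_isBounded hb 2)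
  have hT'm : AEStronglyMeasurable (fun x => deriv Real.smoothTransition (z x - ψ x))
    (volume.restrict Ω) := hTc.comp_aestronglyMeasurable hzψ.1
  have hT1 : MemLp (fun x => Real.smoothTransition (z x - ψ x)) 2 (volume.restrict Ω) := by
    have : IsFiniteMeasure (volume.restrict Ω) := ⟨by simpa using hb.measure_lt_top⟩
    refine MemLp.of_bound (Real.smoothTransition.continuous.comp_aestronglyMeasurable hzψ.1) 1 ?_
    refine Eventually.of_forall fun x => ?_
    rw [Real.norm_of_nonneg (Real.smoothTransition.nonneg _)]
    exact Real.smoothTransition.le_one _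
  have hT2 : MemLp (fun x => deriv Real.smoothTransition (z x - ψ x) • (g x - gradient ψ x)) 2
      (volume.restrict Ω) := by
    refine hgψ.of_le_mul (c := K) (hT'm.smul hgψ.1) (Eventually.of_forall fun x => ?_)
    rw [norm_smul]
    gcongr
    exact hK _
  obtain ⟨φ', hφ', h1', h2'⟩ := hz.approx
  -- Almost everywhere convergence is needed for the coefficients `T'(φ n - ψ)`, with `T` the
  -- transition; this is why a subsequence is taken.
  obtain ⟨ns, hns, hae⟩ := (tendstoInMeasure_of_tendsto_eLpNorm (p := 2) (by norm_num)
    (fun n => ((hφ' n).memLp 2).1) hz.memLp.1 h1').exists_seq_tendsto_ae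
  set φ := fun n => φ' (ns n)
  have hφ : ∀ n, IsTestFunction Ω (φ n) := fun n => hφ' (ns n)
  have h1 := h1'.comp hns.tendsto_atTop
  have h2 := h2'.comp hns.tendsto_atTop
  refine memW12Zero_of_approx hT1 hT2
    ⟨fun n x => Real.smoothTransition (φ n x - ψ x), fun n => ?_, ?_, ?_⟩
  -- Since `ψ ≥ 0`, the truncation vanishes wherever `φ n` does, so no boundary condition on `ψ` is
  -- required.
  · refine (hφ n).of_eq_zero (Real.smoothTransition.contDiff.comp ((hφ n).1.sub hψ)) fun x hx => ?_
    exact Real.smoothTransition.zero_of_nonpos (by simpa [hx] using hψ0 x)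
  · have : Tendsto (fun n => ENNReal.ofReal K *
        eLpNorm (fun x => φ n x - z x) 2 (volume.restrict Ω)) atTop (𝓝 (ENNReal.ofReal K * 0)) :=
      ENNReal.Tendsto.const_mul h1 (Or.inr ENNReal.ofReal_ne_top)
    rw [mul_zero] at this
    refine tendsto_of_tendsto_of_tendsto_of_le_of_le tendsto_const_nhds this
      (fun _ => zero_le) fun n => ?_
    refine eLpNorm_le_mul_eLpNorm_of_ae_le_mul (Eventually.of_forall fun x => ?_) 2
    simpa using hKL (φ n x - ψ x) (z x - ψ x)
  -- The gradient error splits into a term bounded by `K |∇φ_n - g|` and a term with the fixed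
  -- factor `g - ∇ψ`, handled by dominated convergence.
  · have e : ∀ n, (fun x => gradient (fun y => Real.smoothTransition (φ n y - ψ y)) x -
        deriv Real.smoothTransition (z x - ψ x) • (g x - gradient ψ x)) =
        (fun x => deriv Real.smoothTransition (φ n x - ψ x) • (gradient (φ n) x - g x)) +
        (fun x => (deriv Real.smoothTransition (φ n x - ψ x) -
          deriv Real.smoothTransition (z x - ψ x)) • (g x - gradient ψ x)) := by
      intro n
      ext1 x
      rw [gradient_smoothTransition_comp (φ := fun y => φ n y - ψ y)
        ((hφ n).differentiable.sub (hψ.differentiable (by simp)))]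
      have : gradient (fun y => φ n y - ψ y) x = gradient (φ n) x - gradient ψ x := by
        simp only [gradient]
        rw [fderiv_fun_sub ((hφ n).differentiable x) (hψ.differentiable (by simp) x), map_sub]
      rw [this]
      simp only [Pi.add_apply]
      module
    have hm : ∀ n, AEStronglyMeasurable (fun x => deriv Real.smoothTransition (φ n x - ψ x))
        (volume.restrict Ω) := fun n =>
      (hTc.comp ((hφ n).continuous.sub hψ.continuous)).aestronglyMeasurable
    have hA : Tendsto (fun n => eLpNorm (fun x => deriv Real.smoothTransition (φ n x - ψ x) •
        (gradient (φ n) x - g x)) 2 (volume.restrict Ω)) atTop (𝓝 0) := by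
      have : Tendsto (fun n => ENNReal.ofReal K *
          eLpNorm (fun x => gradient (φ n) x - g x) 2 (volume.restrict Ω)) atTop
          (𝓝 (ENNReal.ofReal K * 0)) :=
        ENNReal.Tendsto.const_mul h2 (Or.inr ENNReal.ofReal_ne_top)
      rw [mul_zero] at this
      refine tendsto_of_tendsto_of_tendsto_of_le_of_le tendsto_const_nhds this
        (fun _ => zero_le) fun n => ?_
      refine eLpNorm_le_mul_eLpNorm_of_ae_le_mul (Eventually.of_forall fun x => ?_) 2
      rw [norm_smul]
      gcongr
      exact hK _
    have hB : Tendsto (fun n => eLpNorm (fun x => (deriv Real.smoothTransition (φ n x - ψ x) -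
        deriv Real.smoothTransition (z x - ψ x)) • (g x - gradient ψ x)) 2 (volume.restrict Ω))
        atTop (𝓝 0) := by
      refine tendsto_eLpNorm_two_of_dominated (b := fun x => 2 * K * ‖g x - gradient ψ x‖)
        (fun n => ((hm n).sub hT'm).smul hgψ.1) (hgψ.norm.const_mul _) (fun n => ?_) ?_
      · refine Eventually.of_forall fun x => ?_
        rw [norm_smul]
        gcongr
        refine (norm_sub_le _ _).trans ?_
        have h1 := hK (φ n x - ψ x)
        have h2 := hK (z x - ψ x)
        simp only [Real.norm_eq_abs]
        linarith
      · filter_upwards [hae] with x hx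
        have h3 : Tendsto (fun n => deriv Real.smoothTransition (φ n x - ψ x)) atTop
            (𝓝 (deriv Real.smoothTransition (z x - ψ x))) :=
          (hTc.tendsto _).comp (hx.sub_const (ψ x))
        simpa using (h3.sub_const (deriv Real.smoothTransition (z x - ψ x))).smul_const
          (g x - gradient ψ x)
    have hAB := hA.add hB
    rw [add_zero] at hAB
    refine tendsto_of_tendsto_of_tendsto_of_le_of_le tendsto_const_nhds hAB
      (fun _ => zero_le) fun n => ?_
    simp only [e n]
    refine eLpNorm_add_le ((hm n).smul ((((hφ n).memLp_gradient 2).1).sub hz.memLp_grad.1))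
      (((hm n).sub hT'm).smul hgψ.1) (by norm_num)

end Truncation

/-! ### Weak solutions: existence, energy minimality, uniqueness and symmetry. -/

/-- The Lax–Milgram theorem on a closed subspace `S` of a product, for the form
`⟪p.snd, q.snd⟫` when it is coercive on `S`. -/
lemma IsClosed.exists_inner_snd_eq {H₁ H₂ : Type*} [NormedAddCommGroup H₁] [InnerProductSpace ℝ H₁]
    [CompleteSpace H₁] [NormedAddCommGroup H₂] [InnerProductSpace ℝ H₂] [CompleteSpace H₂]
    {S : Submodule ℝ (WithLp 2 (H₁ × H₂))} (hS : IsClosed (SetLike.coe S)) {C : ℝ}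
    (hC : ∀ p ∈ S, ‖p‖ ^ 2 ≤ C * ‖p.snd‖ ^ 2) (hC0 : 0 < C) (F : H₁) :
    ∃ p ∈ S, ∀ q ∈ S, inner ℝ p.snd q.snd = inner ℝ F q.fst := by
  have : CompleteSpace S := hS.completeSpace_coe
  let P : S →L[ℝ] H₂ := (WithLp.sndL 2 ℝ H₁ H₂).comp S.subtypeL
  let Q : S →L[ℝ] H₁ := (WithLp.fstL 2 ℝ H₁ H₂).comp S.subtypeL
  have hco : IsCoercive ((innerSL ℝ).bilinearComp P P) := by
    refine ⟨C⁻¹, by positivity, fun p => ?_⟩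
    have h := hC p p.2
    rw [mul_assoc, ← sq, inv_mul_le_iff₀ (by positivity)]
    refine h.trans_eq ?_
    rw [← real_inner_self_eq_norm_sq]
    rfl
  refine ⟨hco.continuousLinearEquivOfBilin.symm
    ((InnerProductSpace.toDual ℝ _).symm ((innerSL ℝ F).comp Q)), Subtype.prop _, fun q hq => ?_⟩
  have := hco.continuousLinearEquivOfBilin_apply (hco.continuousLinearEquivOfBilin.symm
    ((InnerProductSpace.toDual ℝ _).symm ((innerSL ℝ F).comp Q))) ⟨q, hq⟩
  rw [ContinuousLinearEquiv.apply_symm_apply, InnerProductSpace.toDual_symm_apply] at this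
  exact this.symm

section WeakSolutions

variable {N : ℕ} {Ω : Set (EuclideanSpace ℝ (Fin N))} {V : EuclideanSpace ℝ (Fin N) → ℝ≥0∞}
  {f f₁ f₂ z w z₁ z₂ : EuclideanSpace ℝ (Fin N) → ℝ}
  {g k g₁ g₂ : EuclideanSpace ℝ (Fin N) → EuclideanSpace ℝ (Fin N)}

lemma potentialMeasure_absolutelyContinuous : potentialMeasure Ω V ≪ volume.restrict Ω :=
  MeasureTheory.withDensity_absolutelyContinuous _ _

namespace IsAdmissible

lemma add (h : IsAdmissible Ω V z g) (h' : IsAdmissible Ω V w k) :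
    IsAdmissible Ω V (fun x => z x + w x) (fun x => g x + k x) :=
  ⟨h.1.add h'.1, h.2.add h'.2⟩

lemma const_smul (h : IsAdmissible Ω V z g) (t : ℝ) :
    IsAdmissible Ω V (fun x => t * z x) (fun x => t • g x) :=
  ⟨h.1.const_smul t, h.2.const_mul t⟩

lemma sub (h : IsAdmissible Ω V z g) (h' : IsAdmissible Ω V w k) :
    IsAdmissible Ω V (fun x => z x - w x) (fun x => g x - k x) :=
  ⟨h.1.sub h'.1, h.2.sub h'.2⟩

lemma congr (h : IsAdmissible Ω V z g) (hz : z =ᵐ[volume.restrict Ω] w)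
    (hg : g =ᵐ[volume.restrict Ω] k) : IsAdmissible Ω V w k :=
  ⟨h.1.congr hz hg, h.2.ae_eq (potentialMeasure_absolutelyContinuous.ae_eq hz)⟩

end IsAdmissible

/-- `z ∈ W_0^{1,2}(Ω) ∩ L²(Ω; V dx)`, with weak gradient `g`, solves `-Δz + Vz = f` weakly. -/
def IsWeakSolution (Ω : Set (EuclideanSpace ℝ (Fin N))) (V : EuclideanSpace ℝ (Fin N) → ℝ≥0∞)
    (f z : EuclideanSpace ℝ (Fin N) → ℝ)
    (g : EuclideanSpace ℝ (Fin N) → EuclideanSpace ℝ (Fin N)) : Prop :=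
  IsAdmissible Ω V z g ∧ ∀ w k, IsAdmissible Ω V w k →
    (∫ x in Ω, inner ℝ (g x) (k x)) + ∫ x, z x * w x ∂(potentialMeasure Ω V) = ∫ x in Ω, f x * w x

/-- The space `W_0^{1,2}(Ω) ∩ L²(Ω; V dx)` as a subspace of a product of `L²` spaces. -/
noncomputable def admissibleSpace (Ω : Set (EuclideanSpace ℝ (Fin N)))
    (V : EuclideanSpace ℝ (Fin N) → ℝ≥0∞) :
    Submodule ℝ (WithLp 2 (Lp ℝ 2 (volume.restrict Ω) ×
      WithLp 2 (Lp (EuclideanSpace ℝ (Fin N)) 2 (volume.restrict Ω) ×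
        Lp ℝ 2 (potentialMeasure Ω V)))) where
  carrier := {p | (p.fst, p.snd.fst) ∈ sobolevZero Ω ∧ p.snd.snd =ᵐ[potentialMeasure Ω V] p.fst}
  add_mem' := by
    rintro p q ⟨h1, h2⟩ ⟨h3, h4⟩
    refine ⟨(sobolevZero Ω).add_mem h1 h3, ?_⟩
    filter_upwards [h2, h4, Lp.coeFn_add p.snd.snd q.snd.snd,
      potentialMeasure_absolutelyContinuous.ae_eq (Lp.coeFn_add p.fst q.fst)] with x a b c d
    simp only [WithLp.add_fst, WithLp.add_snd, c, d, Pi.add_apply, a, b]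
  zero_mem' := by
    refine ⟨(sobolevZero Ω).zero_mem, ?_⟩
    filter_upwards [Lp.coeFn_zero ℝ 2 (potentialMeasure Ω V),
      potentialMeasure_absolutelyContinuous.ae_eq (Lp.coeFn_zero ℝ 2 (volume.restrict Ω))] with x c d
    simp only [WithLp.zero_fst, WithLp.zero_snd, c, d, Pi.zero_apply]
  smul_mem' := by
    rintro t p ⟨h1, h2⟩
    refine ⟨(sobolevZero Ω).smul_mem t h1, ?_⟩
    filter_upwards [h2, Lp.coeFn_smul t p.snd.snd,
      potentialMeasure_absolutelyContinuous.ae_eq (Lp.coeFn_smul t p.fst)] with x a c d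
    simp only [WithLp.smul_fst, WithLp.smul_snd, c, d, Pi.smul_apply, a]

lemma isClosed_admissibleSpace : IsClosed (SetLike.coe (admissibleSpace Ω V)) := by
  rw [← isSeqClosed_iff_isClosed]
  intro p q hp hpq
  have t1 : Tendsto (fun n => (p n).fst) atTop (𝓝 q.fst) :=
    ((WithLp.fstL 2 ℝ _ _).continuous.tendsto q).comp hpq
  have t2 : Tendsto (fun n => (p n).snd) atTop (𝓝 q.snd) :=
    ((WithLp.sndL 2 ℝ _ _).continuous.tendsto q).comp hpq
  have t3 : Tendsto (fun n => (p n).snd.fst) atTop (𝓝 q.snd.fst) :=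
    ((WithLp.fstL 2 ℝ _ _).continuous.tendsto q.snd).comp t2
  have t4 : Tendsto (fun n => (p n).snd.snd) atTop (𝓝 q.snd.snd) :=
    ((WithLp.sndL 2 ℝ _ _).continuous.tendsto q.snd).comp t2
  refine ⟨(testGraph Ω).isClosed_topologicalClosure.mem_of_tendsto (t1.prodMk_nhds t3)
    (Eventually.of_forall fun n => (hp n).1), ?_⟩
  -- Two successive subsequences give almost everywhere convergence for `dx`, then for `V dx`;
  -- absolute continuity allows the limits to be compared for `V dx`.
  obtain ⟨ns, hns, h1⟩ := (tendstoInMeasure_of_tendsto_Lp t1).exists_seq_tendsto_ae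
  obtain ⟨ms, hms, h2⟩ :=
    (tendstoInMeasure_of_tendsto_Lp (t4.comp hns.tendsto_atTop)).exists_seq_tendsto_ae
  filter_upwards [potentialMeasure_absolutelyContinuous.ae_le h1, h2,
    ae_all_iff.2 fun n => (hp n).2] with x a b c
  refine tendsto_nhds_unique b ((a.comp hms.tendsto_atTop).congr fun n => ?_)
  simp [c]

lemma mem_admissibleSpace_of_isAdmissible (h : IsAdmissible Ω V z g) :
    WithLp.toLp 2 (h.1.memLp.toLp z, WithLp.toLp 2 (h.1.memLp_grad.toLp g, h.2.toLp z)) ∈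
      admissibleSpace Ω V := by
  refine ⟨(memW12Zero_iff.1 h.1).2.2, ?_⟩
  filter_upwards [h.2.coeFn_toLp, potentialMeasure_absolutelyContinuous.ae_eq h.1.memLp.coeFn_toLp]
    with x a b
  exact a.trans b.symm

/-- Coercivity for Lax–Milgram: `p.snd` holds the pair (gradient, function in `L²(V dx)`), so its
norm squared is the quadratic form of the equation, and Poincaré controls the remaining component.
-/
lemma norm_sq_le_of_mem_admissibleSpace {C : ℝ}
    (hC : ∀ u g, MemW12Zero Ω u g → ∫ x in Ω, u x ^ 2 ≤ C * ∫ x in Ω, ‖g x‖ ^ 2) (hC0 : 0 < C)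
    {p : WithLp 2 (Lp ℝ 2 (volume.restrict Ω) ×
      WithLp 2 (Lp (EuclideanSpace ℝ (Fin N)) 2 (volume.restrict Ω) ×
        Lp ℝ 2 (potentialMeasure Ω V)))} (hp : p ∈ admissibleSpace Ω V) :
    ‖p‖ ^ 2 ≤ (C + 1) * ‖p.snd‖ ^ 2 := by
  have e := WithLp.prod_norm_sq_eq_of_L2 p
  have e2 := WithLp.prod_norm_sq_eq_of_L2 p.snd
  have h3 := hC _ _ (mem_sobolevZero_iff.1 hp.1)
  have e4 : ‖p.fst‖ ^ 2 = ∫ x in Ω, p.fst x ^ 2 := by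
    rw [← real_inner_self_eq_norm_sq, L2.inner_def]
    simp
  have e5 : ‖p.snd.fst‖ ^ 2 = ∫ x in Ω, ‖p.snd.fst x‖ ^ 2 := by
    rw [← real_inner_self_eq_norm_sq, L2.inner_def]
    simp
  have h6 : ‖p.fst‖ ^ 2 ≤ C * ‖p.snd.fst‖ ^ 2 := by rw [e4, e5]; exact h3
  nlinarith [sq_nonneg ‖p.snd.snd‖]

/-- Existence of weak solutions. -/
lemma exists_isWeakSolution (hN : 1 ≤ N) (hΩ : MeasurableSet Ω) (hb : Bornology.IsBounded Ω)
    (hf : MemLp f 2 (volume.restrict Ω)) : ∃ z g, IsWeakSolution Ω V f z g := by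
  obtain ⟨C, hC0, hC⟩ := exists_poincare hN hΩ hb
  obtain ⟨p, hp, h⟩ := isClosed_admissibleSpace.exists_inner_snd_eq
    (fun p hp => norm_sq_le_of_mem_admissibleSpace (V := V) hC hC0 hp) (by positivity) (hf.toLp f)
  refine ⟨p.fst, p.snd.fst, ⟨mem_sobolevZero_iff.1 hp.1, (Lp.memLp p.snd.snd).ae_eq hp.2⟩,
    fun w k hw => ?_⟩
  have := h _ (mem_admissibleSpace_of_isAdmissible hw)
  have e1 : inner ℝ p.snd.fst (hw.1.memLp_grad.toLp k) = ∫ x in Ω, inner ℝ (p.snd.fst x) (k x) := by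
    rw [L2.inner_def]
    refine integral_congr_ae ?_
    filter_upwards [hw.1.memLp_grad.coeFn_toLp] with x hx
    rw [hx]
  have e2 : inner ℝ p.snd.snd (hw.2.toLp w) =
      ∫ x, p.fst x * w x ∂(potentialMeasure Ω V) := by
    rw [L2.inner_def]
    refine integral_congr_ae ?_
    filter_upwards [hw.2.coeFn_toLp, hp.2] with x hx hx'
    rw [hx, hx']
    simp [mul_comm]
  have e3 : inner ℝ (hf.toLp f) (hw.1.memLp.toLp w) = ∫ x in Ω, f x * w x := by
    rw [inner_toLp_toLp]
    simp [mul_comm]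
  rw [← e1, ← e2, ← e3]
  exact (WithLp.prod_inner_apply _ _).symm.trans this

/-- The energy of a competitor exceeds that of a weak solution by the energy of the difference. -/
lemma IsWeakSolution.energy_eq (hf : MemLp f 2 (volume.restrict Ω)) (h : IsWeakSolution Ω V f z g)
    (hw : IsAdmissible Ω V w k) : energy Ω V f w k = energy Ω V f z g +
      1 / 2 * ((∫ x in Ω, ‖k x - g x‖ ^ 2) + ∫ x, (w x - z x) ^ 2 ∂(potentialMeasure Ω V)) := by
  have hd := hw.sub h.1
  have e := h.2 _ _ hd
  have i1 := hd.1.memLp_grad.norm.integrable_sq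
  have i2 := h.1.1.memLp_grad.norm.integrable_sq
  have i3 := integrable_inner_of_memLp h.1.1.memLp_grad hd.1.memLp_grad
  have i4 := hd.2.integrable_sq
  have i5 := h.1.2.integrable_sq
  have i6 := integrable_mul_of_memLp h.1.2 hd.2
  have i7 := integrable_mul_of_memLp hf hw.1.memLp
  have i8 := integrable_mul_of_memLp hf h.1.1.memLp
  have i23 : Integrable (fun x => ‖g x‖ ^ 2 + 2 * inner ℝ (g x) (k x - g x)) (volume.restrict Ω) :=
    i2.add (i3.const_mul 2)
  have i56 : Integrable (fun x => z x ^ 2 + 2 * (z x * (w x - z x))) (potentialMeasure Ω V) :=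
    i5.add (i6.const_mul 2)
  have e1 : ∫ x in Ω, ‖k x‖ ^ 2 = (∫ x in Ω, ‖g x‖ ^ 2) + 2 * (∫ x in Ω, inner ℝ (g x) (k x - g x)) +
      ∫ x in Ω, ‖k x - g x‖ ^ 2 := by
    rw [← integral_const_mul, ← integral_add i2 (i3.const_mul 2),
      ← integral_add i23 i1]
    refine integral_congr_ae (Eventually.of_forall fun x => ?_)
    have := norm_add_sq_real (g x) (k x - g x)
    rwa [add_sub_cancel] at this
  have e2 : ∫ x, w x ^ 2 ∂(potentialMeasure Ω V) = (∫ x, z x ^ 2 ∂(potentialMeasure Ω V)) +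
      2 * (∫ x, z x * (w x - z x) ∂(potentialMeasure Ω V)) +
      ∫ x, (w x - z x) ^ 2 ∂(potentialMeasure Ω V) := by
    rw [← integral_const_mul, ← integral_add i5 (i6.const_mul 2),
      ← integral_add i56 i4]
    refine integral_congr_ae (Eventually.of_forall fun x => ?_)
    ring
  have e3 : ∫ x in Ω, f x * (w x - z x) = (∫ x in Ω, f x * w x) - ∫ x in Ω, f x * z x := by
    rw [← integral_sub i7 i8]
    simp only [mul_sub]
  simp only [energy]
  linarith

lemma IsWeakSolution.isEnergyMinimizer (hf : MemLp f 2 (volume.restrict Ω))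
    (h : IsWeakSolution Ω V f z g) : IsEnergyMinimizer Ω V f z := by
  refine ⟨g, h.1, fun w k hw => ?_⟩
  rw [h.energy_eq hf hw]
  have h1 : 0 ≤ ∫ x in Ω, ‖k x - g x‖ ^ 2 := integral_nonneg fun x => by positivity
  have h2 : 0 ≤ ∫ x, (w x - z x) ^ 2 ∂(potentialMeasure Ω V) :=
    integral_nonneg fun x => by positivity
  linarith

lemma MemW12Zero.ae_eq_zero (hN : 1 ≤ N) (hΩ : MeasurableSet Ω) (hb : Bornology.IsBounded Ω)
    (h : MemW12Zero Ω z g) (hg : ∫ x in Ω, ‖g x‖ ^ 2 ≤ 0) : z =ᵐ[volume.restrict Ω] 0 := by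
  obtain ⟨C, hC0, hC⟩ := exists_poincare hN hΩ hb
  have h0 : ∫ x in Ω, z x ^ 2 = 0 :=
    le_antisymm ((hC z g h).trans (mul_nonpos_of_nonneg_of_nonpos hC0.le hg))
      (integral_nonneg fun x => sq_nonneg _)
  filter_upwards [(integral_eq_zero_iff_of_nonneg (fun x => sq_nonneg _) h.memLp.integrable_sq).1 h0]
    with x hx
  simpa using hx

/-- By `energy_eq`, the gradient of the difference of a minimizer and a weak solution has zero norm,
and Poincaré concludes. Consequently the arbitrary choice made in `zeta` is harmless almost
everywhere. -/
lemma IsWeakSolution.ae_eq_of_isEnergyMinimizer (hN : 1 ≤ N) (hΩ : MeasurableSet Ω)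
    (hb : Bornology.IsBounded Ω) (hf : MemLp f 2 (volume.restrict Ω))
    (h : IsWeakSolution Ω V f z g) (hw : IsEnergyMinimizer Ω V f w) :
    w =ᵐ[volume.restrict Ω] z := by
  obtain ⟨k, hk, hmin⟩ := hw
  have h0 := hmin _ _ h.1
  rw [h.energy_eq hf hk] at h0
  have h2 : 0 ≤ ∫ x, (w x - z x) ^ 2 ∂(potentialMeasure Ω V) :=
    integral_nonneg fun x => by positivity
  filter_upwards [(hk.1.sub h.1.1).ae_eq_zero hN hΩ hb (by linarith)] with x hx
  simpa [sub_eq_zero] using hx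

lemma isEnergyMinimizer_zeta (hN : 1 ≤ N) (hΩ : MeasurableSet Ω) (hb : Bornology.IsBounded Ω)
    (hf : MemLp f 2 (volume.restrict Ω)) : IsEnergyMinimizer Ω V f (zeta Ω V f) := by
  obtain ⟨z, g, h⟩ := exists_isWeakSolution (V := V) hN hΩ hb hf
  have hex : ∃ z, IsEnergyMinimizer Ω V f z := ⟨z, h.isEnergyMinimizer hf⟩
  rw [zeta, dif_pos hex]
  exact hex.choose_spec

lemma IsWeakSolution.zeta_ae_eq (hN : 1 ≤ N) (hΩ : MeasurableSet Ω) (hb : Bornology.IsBounded Ω)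
    (hf : MemLp f 2 (volume.restrict Ω)) (h : IsWeakSolution Ω V f z g) :
    zeta Ω V f =ᵐ[volume.restrict Ω] z :=
  h.ae_eq_of_isEnergyMinimizer hN hΩ hb hf (isEnergyMinimizer_zeta hN hΩ hb hf)

/-- The solution operator is symmetric. -/
lemma IsWeakSolution.integral_mul_comm (h₁ : IsWeakSolution Ω V f₁ z₁ g₁)
    (h₂ : IsWeakSolution Ω V f₂ z₂ g₂) : ∫ x in Ω, f₁ x * z₂ x = ∫ x in Ω, f₂ x * z₁ x := by
  rw [← h₁.2 _ _ h₂.1, ← h₂.2 _ _ h₁.1]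
  simp only [real_inner_comm, mul_comm]

lemma IsWeakSolution.neg (h : IsWeakSolution Ω V f z g) :
    IsWeakSolution Ω V (fun x => -f x) (fun x => -z x) (fun x => -g x) := by
  refine ⟨by simpa using h.1.const_smul (-1), fun w k hw => ?_⟩
  have := h.2 w k hw
  simp only [inner_neg_left, neg_mul, integral_neg]
  linarith

/-- Adding a bounded potential `t 1_A` amounts to moving `t 1_A z` to the right-hand side. -/
lemma IsWeakSolution.of_add_indicator {A : Set (EuclideanSpace ℝ (Fin N))} (hA : MeasurableSet A)
    (hV : Measurable V) (hf : MemLp f 2 (volume.restrict Ω)) (t : ℝ≥0)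
    (h : IsWeakSolution Ω (fun x => V x + A.indicator (fun _ => (t : ℝ≥0∞)) x) f z g) :
    IsWeakSolution Ω V (fun x => f x - t * A.indicator z x) z g := by
  have hm : potentialMeasure Ω (fun x => V x + A.indicator (fun _ => (t : ℝ≥0∞)) x) =
      potentialMeasure Ω V + (t : ℝ≥0∞) • (volume.restrict Ω).restrict A := by
    simp only [potentialMeasure]
    rw [← withDensity_const, ← withDensity_indicator hA, ← withDensity_add_left hV]
    rfl
  have hle : potentialMeasure Ω V ≤
      potentialMeasure Ω (fun x => V x + A.indicator (fun _ => (t : ℝ≥0∞)) x) := by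
    rw [hm]; exact Measure.le_add_right le_rfl
  refine ⟨⟨h.1.1, h.1.2.mono_measure hle⟩, fun w k hw => ?_⟩
  -- The added potential is bounded, so functions admissible for `V` remain admissible for the
  -- larger potential and can be used as tests there.
  have hw2 : MemLp w 2 ((t : ℝ≥0∞) • (volume.restrict Ω).restrict A) :=
    (hw.1.memLp.restrict A).smul_measure (by simp)
  have hw' : MemLp w 2 (potentialMeasure Ω (fun x => V x + A.indicator (fun _ => (t : ℝ≥0∞)) x)) := by
    rw [hm, memLp_two_iff_integrable_sq]
    · exact hw.2.integrable_sq.add_measure hw2.integrable_sq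
    · exact hw.2.1.add_measure hw2.1
  have e := h.2 w k ⟨hw.1, hw'⟩
  have hz2 : MemLp z 2 ((t : ℝ≥0∞) • (volume.restrict Ω).restrict A) :=
    (h.1.1.memLp.restrict A).smul_measure (by simp)
  rw [hm, integral_add_measure (integrable_mul_of_memLp (h.1.2.mono_measure hle) hw.2)
    (integrable_mul_of_memLp hz2 hw2), integral_smul_measure, ← integral_indicator hA] at e
  have e2 : ∫ x in Ω, (f x - t * A.indicator z x) * w x = (∫ x in Ω, f x * w x) -
      t * ∫ x in Ω, A.indicator (fun x => z x * w x) x := by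
    rw [← integral_const_mul, ← integral_sub (integrable_mul_of_memLp hf hw.1.memLp)
      (((integrable_mul_of_memLp h.1.1.memLp hw.1.memLp).indicator hA).const_mul _)]
    refine integral_congr_ae (Eventually.of_forall fun x => ?_)
    by_cases hx : x ∈ A
    · simp only [hx, indicator_of_mem]
      ring
    · simp [hx]
  rw [e2, ← e]
  simp
  ring

end WeakSolutions

/-! ### The maximum principle, uniformly in the potential. -/

section Comparison

variable {N : ℕ} {Ω : Set (EuclideanSpace ℝ (Fin N))} {V : EuclideanSpace ℝ (Fin N) → ℝ≥0∞}
  {f u z : EuclideanSpace ℝ (Fin N) → ℝ}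
  {g : EuclideanSpace ℝ (Fin N) → EuclideanSpace ℝ (Fin N)}

/-- A bounded nonnegative smooth `ψ` with `-Δψ ≥ 1` on `Ω`, depending on one coordinate. -/
lemma exists_smooth_supersolution (hN : 1 ≤ N) (hb : Bornology.IsBounded Ω) :
    ∃ (C : ℝ) (ψ ρ : EuclideanSpace ℝ (Fin N) → ℝ) (v : EuclideanSpace ℝ (Fin N)),
      0 < C ∧ ContDiff ℝ ∞ ψ ∧ ContDiff ℝ ∞ ρ ∧ (∀ x, 0 ≤ ψ x ∧ ψ x ≤ C) ∧
      (∀ x, gradient ψ x = ρ x • v) ∧ ∀ x ∈ Ω, fderiv ℝ ρ x v ≤ -1 := by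
  obtain ⟨R, hR0, hR⟩ := hb.exists_pos_norm_le
  let i : Fin N := ⟨0, hN⟩
  let L : EuclideanSpace ℝ (Fin N) →L[ℝ] ℝ := R⁻¹ • EuclideanSpace.proj i
  have hLR : ∀ x ∈ Ω, |L x| ≤ 1 := by
    intro x hx
    have : |x i| ≤ R := (PiLp.norm_apply_le x i).trans (hR x hx)
    rw [show L x = R⁻¹ * x i from rfl, abs_mul, abs_inv, abs_of_pos hR0]
    rwa [inv_mul_le_iff₀ hR0, mul_one]
  set v : EuclideanSpace ℝ (Fin N) := EuclideanSpace.single i 1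
  have hLv : ∀ y, L y = R⁻¹ * inner ℝ v y := by
    intro y; simp [L, v, EuclideanSpace.inner_single_left]
  have hLv1 : L v = R⁻¹ := by simp [L, v]
  have hc := Real.cos_one_pos
  -- With `L x = x_0 / R`, which lies in `[-1,1]` on `Ω`, the function `K (2 + cos (L x))` has `-Δ =
  -- K R⁻² cos (L x) ≥ K R⁻² cos 1 = 1` there, and its values lie between `K` and `3 K`.
  set K : ℝ := R ^ 2 / Real.cos 1
  have hK : 0 < K := by positivity
  refine ⟨3 * K, fun x => K * (2 + Real.cos (L x)), fun x => -(K * R⁻¹) * Real.sin (L x), v,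
    by positivity, ?_, ?_, fun x => ⟨?_, ?_⟩, fun x => ?_, fun x hx => ?_⟩
  · exact contDiff_const.mul (contDiff_const.add (Real.contDiff_cos.comp L.contDiff))
  · exact contDiff_const.mul (Real.contDiff_sin.comp L.contDiff)
  · nlinarith [Real.neg_one_le_cos (L x)]
  · nlinarith [Real.cos_le_one (L x)]
  · have h : HasFDerivAt (fun x => K * (2 + Real.cos (L x))) (K • (-Real.sin (L x) • L)) x :=
      ((L.hasFDerivAt (x := x)).cos.const_add 2).const_mul K
    refine ext_inner_right ℝ fun y => ?_
    rw [inner_gradient_left, h.fderiv, inner_smul_left]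
    simp only [smul_apply, smul_eq_mul, hLv, conj_trivial]
    ring
  · have h : HasFDerivAt (fun x => -(K * R⁻¹) * Real.sin (L x))
        ((-(K * R⁻¹)) • (Real.cos (L x) • L)) x := (L.hasFDerivAt (x := x)).sin.const_mul _
    rw [h.fderiv]
    simp only [smul_apply, smul_eq_mul, hLv1]
    have h1 : Real.cos 1 ≤ Real.cos (L x) := by
      rw [← Real.cos_abs (L x)]
      exact Real.cos_le_cos_of_nonneg_of_le_pi (abs_nonneg _) (by linarith [Real.pi_gt_three])
        (hLR x hx)
    have h2 : -(K * R⁻¹) * (Real.cos (L x) * R⁻¹) = -(Real.cos (L x) / Real.cos 1) := by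
      simp only [K]
      field_simp
    rw [h2, neg_le_neg_iff]
    exact (one_le_div hc).2 h1

/-- `C` bounds the solution operators of all the equations `-Δz + Vz = f` on `L^∞(Ω)`. -/
def IsSolutionBound (Ω : Set (EuclideanSpace ℝ (Fin N))) (C : ℝ) : Prop :=
  ∀ (V : EuclideanSpace ℝ (Fin N) → ℝ≥0∞) f z g (M : ℝ), 0 ≤ M →
      MemLp f 2 (volume.restrict Ω) → (∀ᵐ x ∂(volume.restrict Ω), f x ≤ M) →
      IsWeakSolution Ω V f z g → ∀ᵐ x ∂(volume.restrict Ω), z x ≤ C * M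

/-- The maximum principle, with a bound independent of the potential. -/
lemma exists_weakSolution_bound (hN : 1 ≤ N) (hΩ : MeasurableSet Ω) (hb : Bornology.IsBounded Ω) :
    ∃ C : ℝ, 0 < C ∧ IsSolutionBound Ω C := by
  obtain ⟨C, ψ, ρ, v, hC, hψ, hρ, hψ0, hgrad, hsuper⟩ := exists_smooth_supersolution hN hb
  refine ⟨C, hC, fun V f z g M hM hf hfM h => ?_⟩
  obtain ⟨K, hK0, hK, hKL⟩ := Real.smoothTransition.exists_deriv_bound
  have hMψ : ∀ x, 0 ≤ M * ψ x := fun x => mul_nonneg hM (hψ0 x).1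
  -- The test function is `T(z - M ψ)` with `T` the smooth transition; the goal is that it vanishes,
  -- so that `z ≤ M ψ ≤ C M`.
  have hw := h.1.1.smoothTransition_sub hb (contDiff_const.mul hψ) hMψ
  have hgr : gradient (fun x => M * ψ x) = fun x => (M * ρ x) • v := by
    rw [gradient_const_mul' (hψ.differentiable (by simp))]
    ext1 x
    rw [hgrad, smul_smul]
  rw [hgr] at hw
  set w := fun x => Real.smoothTransition (z x - M * ψ x) with hwdef
  set k := fun x => deriv Real.smoothTransition (z x - M * ψ x) • (g x - (M * ρ x) • v)
  have hw0 : ∀ x, 0 ≤ w x := fun x => Real.smoothTransition.nonneg _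
  have hwz : ∀ x, w x ≠ 0 → M * ψ x < z x := by
    intro x hx
    by_contra hlt
    exact hx (Real.smoothTransition.zero_of_nonpos (by linarith))
  have hwadm : IsAdmissible Ω V w k := by
    refine ⟨hw, h.1.2.of_le_mul (c := K)
      (hw.memLp.1.mono_ac potentialMeasure_absolutelyContinuous) (Eventually.of_forall fun x => ?_)⟩
    rw [Real.norm_of_nonneg (hw0 x)]
    by_cases hx : w x = 0
    · rw [hx]; positivity
    · have h1 := hKL (z x - M * ψ x) 0
      rw [Real.smoothTransition.zero, sub_zero, sub_zero, abs_of_nonneg (hw0 x),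
        abs_of_pos (by linarith [hwz x hx])] at h1
      refine h1.trans ?_
      gcongr
      rw [Real.norm_eq_abs]
      linarith [hMψ x, le_abs_self (z x)]
  have hweak := h.2 w k hwadm
  -- The potential term has a favourable sign because `z > M ψ ≥ 0` where `w ≠ 0`; dropping it makes
  -- the bound independent of `V`.
  have hV0 : 0 ≤ ∫ x, z x * w x ∂(potentialMeasure Ω V) := by
    refine integral_nonneg fun x => ?_
    by_cases hx : w x = 0
    · simp [hx]
    · exact mul_nonneg ((hMψ x).trans (hwz x hx).le) (hw0 x)
  have : IsFiniteMeasure (volume.restrict Ω) := ⟨by simpa using hb.measure_lt_top⟩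
  have hwint : Integrable w (volume.restrict Ω) := hw.memLp.integrable (by norm_num)
  have hfw : ∫ x in Ω, f x * w x ≤ M * ∫ x in Ω, w x := by
    rw [← integral_const_mul]
    refine integral_mono_ae (integrable_mul_of_memLp hf hw.memLp) (hwint.const_mul M) ?_
    filter_upwards [hfM] with x hx
    exact mul_le_mul_of_nonneg_right hx (hw0 x)
  have hparts := hw.integral_mul_inner hb hρ v
  have hρ' : MemLp (fun x => fderiv ℝ ρ x v) 2 (volume.restrict Ω) :=
    ((hρ.continuous_fderiv (by simp)).clm_apply continuous_const).memLp_restrict_of_isBounded hb 2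
  have hψw : ∫ x in Ω, w x ≤ ∫ x in Ω, ρ x * inner ℝ (k x) v := by
    rw [hparts, ← integral_neg]
    refine integral_mono_ae hwint (integrable_mul_of_memLp hρ' hw.memLp).neg ?_
    refine (ae_restrict_iff' hΩ).2 (Eventually.of_forall fun x hx => ?_)
    nlinarith [hsuper x hx, hw0 x]
  have hρv : MemLp (fun x => (M * ρ x) • v) 2 (volume.restrict Ω) :=
    ((continuous_const.mul hρ.continuous).smul continuous_const).memLp_restrict_of_isBounded hb 2
  have i1 := integrable_inner_of_memLp h.1.1.memLp_grad hw.memLp_grad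
  have i2 := integrable_inner_of_memLp hρv hw.memLp_grad
  have hkey : ∫ x in Ω, inner ℝ (g x - (M * ρ x) • v) (k x) ≤ 0 := by
    simp only [inner_sub_left]
    rw [integral_sub i1 i2]
    have : ∫ x in Ω, inner ℝ ((M * ρ x) • v) (k x) = M * ∫ x in Ω, ρ x * inner ℝ (k x) v := by
      rw [← integral_const_mul]
      refine integral_congr_ae (Eventually.of_forall fun x => ?_)
      simp only [inner_smul_left, real_inner_comm, conj_trivial]
      ring
    rw [this]
    have := mul_le_mul_of_nonneg_left hψw hM
    linarith
  -- Here `k = T' (g - M∇ψ)`, and `T'^2 ≤ K T'` bounds `|k|²` by `K` times the integrand of `hkey`.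
  have hk : ∫ x in Ω, ‖k x‖ ^ 2 ≤ 0 := by
    have : ∫ x in Ω, ‖k x‖ ^ 2 ≤ ∫ x in Ω, K * inner ℝ (g x - (M * ρ x) • v) (k x) := by
      refine integral_mono hw.memLp_grad.norm.integrable_sq
        ((integrable_inner_of_memLp (h.1.1.memLp_grad.sub hρv) hw.memLp_grad).const_mul K)
        fun x => ?_
      have hd : 0 ≤ deriv Real.smoothTransition (z x - M * ψ x) :=
        Real.smoothTransition.monotone.deriv_nonneg
      have hdK := (le_abs_self _).trans (hK (z x - M * ψ x))
      simp only [k, norm_smul, mul_pow, Real.norm_eq_abs, sq_abs, inner_smul_right,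
        real_inner_self_eq_norm_sq]
      rw [sq, ← mul_assoc]
      gcongr
    rw [integral_const_mul] at this
    exact this.trans (mul_nonpos_of_nonneg_of_nonpos hK0.le hkey)
  filter_upwards [hw.ae_eq_zero hN hΩ hb hk] with x hx
  have h1 : z x - M * ψ x ≤ 0 := Real.smoothTransition.zero_iff_nonpos.1 hx
  nlinarith [(hψ0 x).2]

end Comparison

/-! ### Dual supersolutions and the weak-type estimate. -/

section WeakType

variable {N : ℕ} {Ω : Set (EuclideanSpace ℝ (Fin N))} {V : EuclideanSpace ℝ (Fin N) → ℝ≥0∞}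
  {f u w z h : EuclideanSpace ℝ (Fin N) → ℝ}
  {g k : EuclideanSpace ℝ (Fin N) → EuclideanSpace ℝ (Fin N)} {C : ℝ}

/-- `u` is a supersolution of `-Δu + Vu ≥ 0` by duality: `∫ u f ≥ 0` whenever `f` is bounded and
the solution with datum `f` is nonnegative. -/
def IsDualSupersolution (Ω : Set (EuclideanSpace ℝ (Fin N)))
    (V : EuclideanSpace ℝ (Fin N) → ℝ≥0∞) (u : EuclideanSpace ℝ (Fin N) → ℝ) : Prop :=
  ∀ f z g, MemLp f ∞ (volume.restrict Ω) → IsWeakSolution Ω V f z g →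
    0 ≤ᵐ[volume.restrict Ω] z → 0 ≤ ∫ x in Ω, u x * f x

/-- The bound with `M = 0`, applied to the datum `-f`. -/
lemma IsSolutionBound.nonneg (hC : IsSolutionBound Ω C) (hf : MemLp f 2 (volume.restrict Ω))
    (hf0 : 0 ≤ᵐ[volume.restrict Ω] f) (hz : IsWeakSolution Ω V f z g) :
    0 ≤ᵐ[volume.restrict Ω] z := by
  have := hC V _ _ _ 0 le_rfl hf.neg (by filter_upwards [hf0] with x hx; simpa using hx) hz.neg
  filter_upwards [this] with x hx
  simpa using hx

/-- Weak-type estimate: `s ∫_{u ≥ s} z ≤ C ∫ u h` when `z` solves the equation with datum `h`. -/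
lemma IsDualSupersolution.mul_integral_indicator_le (hN : 1 ≤ N) (hΩ : MeasurableSet Ω)
    (hb : Bornology.IsBounded Ω) (hV : Measurable V) (hC0 : 0 < C) (hC : IsSolutionBound Ω C)
    (hu : IntegrableOn u Ω) (hum : Measurable u) (hD : IsDualSupersolution Ω V u)
    (hh : MemLp h ∞ (volume.restrict Ω)) (hh0 : 0 ≤ᵐ[volume.restrict Ω] h)
    (hz : IsWeakSolution Ω V h z g) {s : ℝ} (hs : 0 < s) :
    s * ∫ x in Ω, {y | s ≤ u y}.indicator z x ≤ C * ∫ x in Ω, u x * h x := by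
  have : IsFiniteMeasure (volume.restrict Ω) := ⟨by simpa using hb.measure_lt_top⟩
  set A := {y | s ≤ u y}
  have hA : MeasurableSet A := measurableSet_le measurable_const hum
  have hh2 : MemLp h 2 (volume.restrict Ω) := hh.mono_exponent le_top
  set J := ∫ x in Ω, u x * h x
  have h1A : MemLp (A.indicator fun _ => (1 : ℝ)) 2 (volume.restrict Ω) :=
    (memLp_const 1).indicator hA
  -- `y` is the dual function `G(1_A)`: by symmetry, integrating a solution over `A` amounts to
  -- integrating its datum against `y ≤ C`.
  obtain ⟨y, gy, hy⟩ := exists_isWeakSolution (V := V) hN hΩ hb h1A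
  have hyC : ∀ᵐ x ∂(volume.restrict Ω), y x ≤ C := by
    have := hC V _ _ _ 1 zero_le_one h1A
      (Eventually.of_forall fun x => indicator_le_self' (by simp) x) hy
    simpa using this
  obtain ⟨M, hM0, hM⟩ : ∃ M : ℝ, 0 ≤ M ∧ ∀ᵐ x ∂(volume.restrict Ω), h x ≤ M := by
    refine ⟨(eLpNorm h ∞ (volume.restrict Ω)).toReal, ENNReal.toReal_nonneg, ?_⟩
    filter_upwards [ae_le_eLpNormEssSup (f := h) (μ := volume.restrict Ω)] with x hx
    rw [← eLpNorm_exponent_top] at hx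
    have := ENNReal.toReal_mono hh.2.ne hx
    rw [toReal_enorm] at this
    exact (le_abs_self _).trans this
  have hstep : ∀ n : ℕ, s * ∫ x in Ω, A.indicator z x ≤ J * (1 / ((n : ℝ) + 1)) + C * J := by
    intro n
    set t : ℝ≥0 := n + 1
    have ht : (0 : ℝ) < t := by simp only [t]; positivity
    obtain ⟨zn, gn, hzn'⟩ := exists_isWeakSolution
      (V := fun x => V x + A.indicator (fun _ => (t : ℝ≥0∞)) x) hN hΩ hb hh2
    have hzn := hzn'.of_add_indicator hA hV hh2 t
    have hzn0 := hC.nonneg hh2 hh0 hzn'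
    have hznM := hC _ _ _ _ M hM0 hh2 hM hzn'
    -- Boundedness of `zn` makes `h - t 1_A zn` a legitimate datum in the duality inequality, which
    -- accepts only bounded functions.
    have hznb : MemLp zn ∞ (volume.restrict Ω) := by
      refine memLp_top_of_bound hzn.1.1.memLp.1 (C * M) ?_
      filter_upwards [hzn0, hznM] with x a b
      rwa [Real.norm_of_nonneg a]
    have hfb : MemLp (fun x => h x - t * A.indicator zn x) ∞ (volume.restrict Ω) :=
      hh.sub ((hznb.indicator hA).const_mul _)
    have hD' := hD _ _ _ hfb hzn hzn0
    have iu1 : Integrable (fun x => u x * h x) (volume.restrict Ω) := hu.mul_of_top_left hh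
    have iu2 : Integrable (fun x => u x * A.indicator zn x) (volume.restrict Ω) :=
      hu.mul_of_top_left (hznb.indicator hA)
    have i3 : Integrable (A.indicator zn) (volume.restrict Ω) :=
      (hznb.integrable le_top).indicator hA
    have e1 : ∫ x in Ω, u x * (h x - t * A.indicator zn x) =
        J - t * ∫ x in Ω, u x * A.indicator zn x := by
      rw [← integral_const_mul, ← integral_sub iu1 (iu2.const_mul _)]
      refine integral_congr_ae (Eventually.of_forall fun x => ?_)
      ring
    have e2 : s * ∫ x in Ω, A.indicator zn x ≤ ∫ x in Ω, u x * A.indicator zn x := by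
      rw [← integral_const_mul]
      refine integral_mono_ae (i3.const_mul s) iu2 ?_
      filter_upwards [hzn0] with x hx
      by_cases hxA : x ∈ A
      · simp only [hxA, indicator_of_mem]
        exact mul_le_mul_of_nonneg_right hxA hx
      · simp [hxA]
    have hI : s * (t * ∫ x in Ω, A.indicator zn x) ≤ J := by
      have := mul_le_mul_of_nonneg_left e2 ht.le
      linarith
    have e3 := hzn.integral_mul_comm hy
    have e4 := hz.integral_mul_comm hy
    have hind : ∀ q : EuclideanSpace ℝ (Fin N) → ℝ,
        ∫ x in Ω, A.indicator (fun _ => (1 : ℝ)) x * q x = ∫ x in Ω, A.indicator q x := by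
      intro q
      refine integral_congr_ae (Eventually.of_forall fun x => ?_)
      by_cases hxA : x ∈ A <;> simp [hxA]
    rw [hind] at e3 e4
    have hzn2 : MemLp (A.indicator zn) 2 (volume.restrict Ω) := hzn.1.1.memLp.indicator hA
    have iy1 := integrable_mul_of_memLp hh2 hy.1.1.memLp
    have iy2 := integrable_mul_of_memLp hzn2 hy.1.1.memLp
    have e5 : ∫ x in Ω, (h x - t * A.indicator zn x) * y x =
        (∫ x in Ω, h x * y x) - t * ∫ x in Ω, A.indicator zn x * y x := by
      rw [← integral_const_mul, ← integral_sub iy1 (iy2.const_mul _)]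
      refine integral_congr_ae (Eventually.of_forall fun x => ?_)
      ring
    have e6 : ∫ x in Ω, A.indicator zn x * y x ≤ C * ∫ x in Ω, A.indicator zn x := by
      rw [← integral_const_mul]
      refine integral_mono_ae iy2 (i3.const_mul C) ?_
      filter_upwards [hzn0, hyC] with x hx hx'
      rw [mul_comm C]
      exact mul_le_mul_of_nonneg_left hx' (indicator_apply_nonneg fun _ => hx)
    have e7 : s * ∫ x in Ω, A.indicator zn x ≤ J * (1 / ((n : ℝ) + 1)) := by
      rw [mul_one_div, le_div_iff₀ (by positivity)]
      refine le_trans (le_of_eq ?_) hI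
      simp only [t, NNReal.coe_add, NNReal.coe_natCast, NNReal.coe_one]
      ring
    -- Subtracting the two symmetry identities `e3` and `e4` leaves the contribution of the datum `t
    -- 1_A zn`, estimated through `y ≤ C`.
    have e8 : ∫ x in Ω, A.indicator z x ≤
        (∫ x in Ω, A.indicator zn x) + C * (t * ∫ x in Ω, A.indicator zn x) := by
      have := mul_le_mul_of_nonneg_left e6 ht.le
      linarith
    have := mul_le_mul_of_nonneg_left e8 hs.le
    have := mul_le_mul_of_nonneg_left hI hC0.le
    linarith
  have hlim : Tendsto (fun n : ℕ => J * (1 / ((n : ℝ) + 1)) + C * J) atTop (𝓝 (J * 0 + C * J)) :=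
    (tendsto_one_div_add_atTop_nhds_zero_nat.const_mul J).add_const _
  rw [mul_zero, zero_add] at hlim
  exact ge_of_tendsto' hlim hstep

end WeakType

/-! ### Integration over levels, and the comparison. -/

section Main

variable {N : ℕ} {Ω : Set (EuclideanSpace ℝ (Fin N))} {V : EuclideanSpace ℝ (Fin N) → ℝ≥0∞}
  {f u w z h : EuclideanSpace ℝ (Fin N) → ℝ}
  {g k : EuclideanSpace ℝ (Fin N) → EuclideanSpace ℝ (Fin N)} {C : ℝ}

/-- A function with weak-type decay `ν {u ≥ s} ≤ B / s` satisfies `∫ min(u,1)^α ≤ α / (α - 1) B`. -/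
lemma lintegral_min_one_rpow_le {α : Type*} {m : MeasurableSpace α} {ν : Measure α} {v : α → ℝ}
    (hv : Measurable v) (hv0 : 0 ≤ᵐ[ν] v) {B p : ℝ} (hB : 0 ≤ B) (hp : 1 < p)
    (hweak : ∀ s, 0 < s → ν {a | s ≤ v a} ≤ ENNReal.ofReal (B / s)) :
    ∫⁻ a, ENNReal.ofReal (min (v a) 1 ^ p) ∂ν ≤ ENNReal.ofReal (p / (p - 1) * B) := by
  have hp0 : 0 < p - 1 := by linarith
  rw [lintegral_rpow_eq_lintegral_meas_le_mul ν
    (by filter_upwards [hv0] with x hx using le_min hx zero_le_one)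
    (hv.min measurable_const).aemeasurable (by linarith)]
  -- Multiplying the decay `B / t` by the layer-cake weight `t^(p-1)` gives `t^(p-2)`, integrable at
  -- `0` exactly because `p > 1`; truncating at `1` removes the levels beyond.
  have hint : IntervalIntegrable (fun t : ℝ => B * t ^ (p - 2)) volume 0 1 :=
    (intervalIntegral.intervalIntegrable_rpow' (by linarith)).const_mul B
  have hval : ∫ t in Ioc (0 : ℝ) 1, B * t ^ (p - 2) = B / (p - 1) := by
    rw [← intervalIntegral.integral_of_le zero_le_one, intervalIntegral.integral_const_mul,
      integral_rpow (Or.inl (by linarith))]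
    rw [show p - 2 + 1 = p - 1 by ring, Real.one_rpow, Real.zero_rpow hp0.ne']
    ring
  have hle : ∫⁻ t in Ioi (0 : ℝ), ν {a | t ≤ min (v a) 1} * ENNReal.ofReal (t ^ (p - 1)) ≤
      ENNReal.ofReal (B / (p - 1)) := by
    rw [← hval, ofReal_integral_eq_lintegral_ofReal]
    · rw [← lintegral_indicator measurableSet_Ioi, ← lintegral_indicator measurableSet_Ioc]
      refine lintegral_mono fun t => ?_
      by_cases ht0 : 0 < t
      · by_cases ht1 : t ≤ 1
        · rw [indicator_of_mem (show t ∈ Ioi 0 from ht0), indicator_of_mem (show t ∈ Ioc 0 1 from ⟨ht0, ht1⟩)]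
          have hsub : {a | t ≤ min (v a) 1} ⊆ {a | t ≤ v a} := fun a ha =>
            le_trans (show t ≤ min (v a) 1 from ha) (min_le_left _ _)
          calc ν {a | t ≤ min (v a) 1} * ENNReal.ofReal (t ^ (p - 1))
              ≤ ENNReal.ofReal (B / t) * ENNReal.ofReal (t ^ (p - 1)) := by
                gcongr
                exact (measure_mono hsub).trans (hweak t ht0)
            _ = ENNReal.ofReal (B * t ^ (p - 2)) := by
                rw [← ENNReal.ofReal_mul (by positivity), show p - 1 = (p - 2) + 1 by ring,
                  Real.rpow_add_one ht0.ne']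
                congr 1
                field_simp
        · have : {a | t ≤ min (v a) 1} = ∅ := by
            ext a
            simp only [mem_ofPred_eq, mem_empty_iff_false, iff_false]
            exact fun h => ht1 (h.trans (min_le_right _ _))
          rw [indicator_of_mem (show t ∈ Ioi 0 from ht0), this]
          simp
      · rw [indicator_of_notMem (show t ∉ Ioi 0 from ht0)]
        exact zero_le
    · exact (intervalIntegrable_iff_integrableOn_Ioc_of_le zero_le_one).1 hint
    · refine (ae_restrict_iff' measurableSet_Ioc).2 (Eventually.of_forall fun t ht => ?_)
      exact mul_nonneg hB (Real.rpow_nonneg ht.1.le _)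
  calc _ ≤ ENNReal.ofReal p * ENNReal.ofReal (B / (p - 1)) := by gcongr
    _ = _ := by
      rw [← ENNReal.ofReal_mul (by linarith)]
      congr 1
      ring

/-- The weak-type estimate says that the measure `z dx` gives `{u ≥ s}` mass at most `C (∫ u h) /
s`, so the layer-cake bound applies to it. -/
lemma IsDualSupersolution.integral_min_one_rpow_mul_le (hN : 1 ≤ N) (hΩ : MeasurableSet Ω)
    (hb : Bornology.IsBounded Ω) (hV : Measurable V) (hC0 : 0 < C) (hC : IsSolutionBound Ω C)
    (hu : IntegrableOn u Ω) (hum : Measurable u) (hu0 : 0 ≤ᵐ[volume.restrict Ω] u)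
    (hD : IsDualSupersolution Ω V u)
    (hh : MemLp h ∞ (volume.restrict Ω)) (hh0 : 0 ≤ᵐ[volume.restrict Ω] h)
    (hz : IsWeakSolution Ω V h z g) {p : ℝ} (hp : 1 < p) :
    ∫ x in Ω, min (u x) 1 ^ p * z x ≤ p / (p - 1) * (C * ∫ x in Ω, u x * h x) := by
  have : IsFiniteMeasure (volume.restrict Ω) := ⟨by simpa using hb.measure_lt_top⟩
  have hz0 := hC.nonneg (hh.mono_exponent le_top) hh0 hz
  have hzi : Integrable z (volume.restrict Ω) := hz.1.1.memLp.integrable (by norm_num)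
  have hJ : 0 ≤ ∫ x in Ω, u x * h x := by
    refine integral_nonneg_of_ae ?_
    filter_upwards [hu0, hh0] with x a b using mul_nonneg a b
  have hzm : AEMeasurable (fun x => ENNReal.ofReal (z x)) (volume.restrict Ω) :=
    hzi.1.aemeasurable.ennreal_ofReal
  have key := lintegral_min_one_rpow_le
    (ν := (volume.restrict Ω).withDensity fun x => ENNReal.ofReal (z x)) hum
    ((withDensity_absolutelyContinuous _ _).ae_le hu0) (mul_nonneg hC0.le hJ) hp (fun s hs => ?_)
  · have hm : Measurable fun x => min (u x) 1 ^ p := (hum.min measurable_const).pow_const p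
    rw [lintegral_withDensity_eq_lintegral_mul₀ hzm hm.ennreal_ofReal.aemeasurable] at key
    rw [integral_eq_lintegral_of_nonneg_ae]
    · refine ENNReal.toReal_le_of_le_ofReal ?_ ((le_of_eq ?_).trans key)
      · have : 0 < p - 1 := by linarith
        positivity
      · refine lintegral_congr_ae ?_
        filter_upwards [hz0] with x hx
        simp only [Pi.mul_apply]
        rw [← ENNReal.ofReal_mul hx, mul_comm]
    · filter_upwards [hz0, hu0] with x a b
      exact mul_nonneg (Real.rpow_nonneg (le_min b zero_le_one) _) a
    · exact hm.aestronglyMeasurable.mul hzi.1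
  · have hA : MeasurableSet {a | s ≤ u a} := measurableSet_le measurable_const hum
    rw [withDensity_apply _ hA, ← ofReal_integral_eq_lintegral_ofReal hzi.restrict
      (ae_restrict_of_ae hz0), ← integral_indicator hA]
    refine ENNReal.ofReal_le_ofReal ((le_div_iff₀ hs).2 ?_)
    rw [mul_comm]
    exact hD.mul_integral_indicator_le hN hΩ hb hV hC0 hC hu hum hh hh0 hz hs

lemma IsWeakSolution.congr_datum {f' : EuclideanSpace ℝ (Fin N) → ℝ} (h : IsWeakSolution Ω V f z g)
    (hf : f =ᵐ[volume.restrict Ω] f') : IsWeakSolution Ω V f' z g := by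
  refine ⟨h.1, fun w k hw => (h.2 w k hw).trans (integral_congr_ae ?_)⟩
  filter_upwards [hf] with x hx
  rw [hx]

/-- Solutions with datum `c min(u,1)^p` lie below a nonnegative dual supersolution `u`. -/
lemma IsDualSupersolution.ae_le (hN : 1 ≤ N) (hΩ : MeasurableSet Ω)
    (hb : Bornology.IsBounded Ω) (hV : Measurable V) (hC0 : 0 < C) (hC : IsSolutionBound Ω C)
    (hu : IntegrableOn u Ω) (hu0 : 0 ≤ᵐ[volume.restrict Ω] u) (hD : IsDualSupersolution Ω V u)
    {p : ℝ} (hp : 1 < p) (hw : IsWeakSolution Ω V (fun x => (p - 1) / (p * C) * min (u x) 1 ^ p) w k) :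
    w ≤ᵐ[volume.restrict Ω] u := by
  have : IsFiniteMeasure (volume.restrict Ω) := ⟨by simpa using hb.measure_lt_top⟩
  -- Level sets of `u` serve as supports of potentials and must be measurable; all the hypotheses
  -- are stable under changing `u` on a null set.
  wlog hum : Measurable u generalizing u
  · have hmk := hu.1.ae_eq_mk
    have hmm : Measurable (hu.1.mk u) := hu.1.stronglyMeasurable_mk.measurable
    refine (this (Integrable.congr hu hmk) ?_ ?_ (hw.congr_datum ?_) hmm).trans hmk.symm.le
    · filter_upwards [hu0, hmk] with x a b
      rwa [← b]
    · intro f z g hf hz hz0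
      refine (hD f z g hf hz hz0).trans_eq (integral_congr_ae ?_)
      filter_upwards [hmk] with x a
      rw [a]
    · filter_upwards [hmk] with x a
      rw [a]
  have hp0 : 0 < p - 1 := by linarith
  have hwi : Integrable w (volume.restrict Ω) := hw.1.1.memLp.integrable (by norm_num)
  -- Testing with `h = 1_s`, symmetry turns `∫_s w` into `c ∫ min(u,1)^p G(1_s)`, and the constant
  -- `c` cancels `p C / (p - 1)` exactly.
  have key : ∀ s, MeasurableSet s → volume.restrict Ω s < ⊤ → 0 ≤ ∫ x in s, (u x - w x)
      ∂(volume.restrict Ω) := by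
    intro s hs _
    have hh : MemLp (s.indicator fun _ => (1 : ℝ)) ∞ (volume.restrict Ω) :=
      (memLp_const 1).indicator hs
    have hh0 : 0 ≤ᵐ[volume.restrict Ω] s.indicator fun _ => (1 : ℝ) :=
      Eventually.of_forall fun x => indicator_apply_nonneg fun _ => zero_le_one
    obtain ⟨z, g, hz⟩ := exists_isWeakSolution (V := V) hN hΩ hb (hh.mono_exponent le_top)
    have h1 := hD.integral_min_one_rpow_mul_le hN hΩ hb hV hC0 hC hu hum hu0 hh hh0 hz hp
    have h2 := hw.integral_mul_comm hz
    simp only [mul_assoc, integral_const_mul] at h2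
    have hind : ∀ q : EuclideanSpace ℝ (Fin N) → ℝ,
        ∫ x in Ω, s.indicator (fun _ => (1 : ℝ)) x * q x =
          ∫ x in s, q x ∂(volume.restrict Ω) := by
      intro q
      rw [← integral_indicator hs]
      refine integral_congr_ae (Eventually.of_forall fun x => ?_)
      by_cases hx : x ∈ s <;> simp [hx]
    have e1 : ∫ x in Ω, u x * s.indicator (fun _ => (1 : ℝ)) x =
        ∫ x in s, u x ∂(volume.restrict Ω) := by
      rw [← hind]
      simp only [mul_comm]
    rw [e1] at h1
    rw [hind] at h2
    rw [integral_sub (Integrable.restrict hu) hwi.restrict, ← h2, sub_nonneg]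
    have hc : 0 < (p - 1) / (p * C) := by positivity
    refine (mul_le_mul_of_nonneg_left h1 hc.le).trans_eq ?_
    have : p ≠ 0 := by positivity
    field_simp
  have := ae_nonneg_of_forall_setIntegral_nonneg (hu.sub hwi) key
  filter_upwards [this] with x hx
  simpa using hx

/-- The precise representative of a nonnegative function is nonnegative. -/
lemma preciseRep_nonneg {v : EuclideanSpace ℝ (Fin N) → ℝ} (hΩ : IsOpen Ω)
    (hv : 0 ≤ᵐ[volume.restrict Ω] v) {x : EuclideanSpace ℝ (Fin N)} (hx : x ∈ Ω) :
    0 ≤ preciseRep v x := by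
  rw [preciseRep]
  split_ifs with h
  · by_contra! hc
    have hspec := h.choose_spec
    set c := h.choose
    obtain ⟨ε, hε, hball⟩ := Metric.isOpen_iff.1 hΩ x hx
    -- If `c < 0 ≤ v`, then `|v - c| ≥ -c` almost everywhere near `x`, so the averages stay away
    -- from `0`.
    have hge : ∀ᶠ r in 𝓝[>] (0 : ℝ), ENNReal.ofReal (-c) ≤
        laverage (volume.restrict (Metric.ball x r)) fun y => ‖v y - c‖ₑ := by
      filter_upwards [Ioo_mem_nhdsGT hε] with r hr
      have hae : ∀ᵐ y ∂(volume.restrict (Metric.ball x r)), 0 ≤ v y :=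
        ae_restrict_of_ae_restrict_of_subset ((Metric.ball_subset_ball hr.2.le).trans hball) hv
      rw [← setLAverage_const (Metric.measure_ball_pos volume x hr.1).ne'
        measure_ball_lt_top.ne (ENNReal.ofReal (-c)), laverage_eq, laverage_eq]
      gcongr ?_ / _
      refine lintegral_mono_ae ?_
      filter_upwards [hae] with y hy
      rw [← ofReal_norm]
      refine ENNReal.ofReal_le_ofReal ?_
      rw [Real.norm_eq_abs]
      linarith [le_abs_self (v y - c)]
    have := ge_of_tendsto hspec hge
    rw [nonpos_iff_eq_zero, ENNReal.ofReal_eq_zero] at this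
    linarith
  -- Off the Lebesgue points the default value `0` has the right sign, so no regularity of `v` is
  -- needed.
  · exact le_rfl

/-- The integral of a pointwise nonnegative function against `μ` is nonnegative; `preciseRep_nonneg`
supplies this sign everywhere in `Ω`, including on Lebesgue-null sets that `μ` may charge. -/
lemma IsDualitySolution.isDualSupersolution (hN : 1 ≤ N) (hΩ : IsOpen Ω)
    (hb : Bornology.IsBounded Ω) {μ : Measure (EuclideanSpace ℝ (Fin N))}
    (h : IsDualitySolution Ω V μ u) : IsDualSupersolution Ω V u := by
  intro f z g hf hz hz0
  have : IsFiniteMeasure (volume.restrict Ω) := ⟨by simpa using hb.measure_lt_top⟩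
  rw [h.2 f hf]
  refine setIntegral_nonneg hΩ.measurableSet fun x hx => preciseRep_nonneg hΩ ?_ hx
  filter_upwards [hz0, hz.zeta_ae_eq hN hΩ.measurableSet hb (hf.mono_exponent le_top)] with x a b
  rwa [b]

/-- Indicators are bounded data with nonnegative solutions, so `u` has nonnegative integral over
every measurable set. -/
lemma IsDualSupersolution.nonneg (hN : 1 ≤ N) (hΩ : MeasurableSet Ω)
    (hb : Bornology.IsBounded Ω) (hC : IsSolutionBound Ω C) (hu : IntegrableOn u Ω)
    (hD : IsDualSupersolution Ω V u) : 0 ≤ᵐ[volume.restrict Ω] u := by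
  have : IsFiniteMeasure (volume.restrict Ω) := ⟨by simpa using hb.measure_lt_top⟩
  refine ae_nonneg_of_forall_setIntegral_nonneg hu fun s hs _ => ?_
  have hh : MemLp (s.indicator fun _ => (1 : ℝ)) ∞ (volume.restrict Ω) :=
    (memLp_const 1).indicator hs
  have hh2 := hh.mono_exponent (p := 2) le_top
  obtain ⟨z, g, hz⟩ := exists_isWeakSolution (V := V) hN hΩ hb hh2
  refine (hD _ z g hh hz (hC.nonneg hh2 (Eventually.of_forall fun x =>
    indicator_apply_nonneg fun _ => zero_le_one) hz)).trans_eq ?_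
  rw [← integral_indicator hs]
  refine integral_congr_ae (Eventually.of_forall fun x => ?_)
  by_cases hx : x ∈ s <;> simp [hx]

lemma min_rpow_one {t p : ℝ} (ht : 0 ≤ t) (hp : 0 < p) : min (t ^ p) 1 = min t 1 ^ p := by
  rcases le_total t 1 with h | h
  · rw [min_eq_left h, min_eq_left (Real.rpow_le_one ht h hp.le)]
  · rw [min_eq_right h, min_eq_right (Real.one_le_rpow h hp.le), Real.one_rpow]

/-- The constant is fixed before `V`, `μ` and `u` are introduced, and depends only on `p` and the
bound `C` for `Ω`. -/
lemma exists_comparisonHolds (hN : 1 ≤ N) (hΩ : IsOpen Ω) (hb : Bornology.IsBounded Ω) {p : ℝ}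
    (hp : 1 < p) : ∃ c : ℝ≥0, 0 < c ∧ ComparisonHolds Ω (fun t => c * min (t ^ p) 1) := by
  have : IsFiniteMeasure (volume.restrict Ω) := ⟨by simpa using hb.measure_lt_top⟩
  have hΩm := hΩ.measurableSet
  obtain ⟨C, hC0, hC⟩ := exists_weakSolution_bound hN hΩm hb
  have hp0 : 0 < p - 1 := by linarith
  have hc : 0 < (p - 1) / (p * C) := by positivity
  obtain ⟨c, hcv⟩ : ∃ c : ℝ≥0, (c : ℝ) = (p - 1) / (p * C) := ⟨⟨_, hc.le⟩, rfl⟩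
  refine ⟨c, NNReal.coe_pos.1 (hcv ▸ hc), fun V hV μ _ u hu => ?_⟩
  have hD := hu.isDualSupersolution hN hΩ hb
  have hu0 := hD.nonneg hN hΩm hb hC hu.1
  set H : ℝ≥0 → ℝ≥0 := fun t => c * min (t ^ p) 1 with hH
  have hcomp : compNonneg H u =ᵐ[volume.restrict Ω]
      fun x => (p - 1) / (p * C) * min (u x) 1 ^ p := by
    filter_upwards [hu0] with x hx
    have hx' : 0 ≤ u x := hx
    simp only [compNonneg, hH, NNReal.coe_mul, hcv, NNReal.coe_min, NNReal.coe_rpow,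
      NNReal.coe_one, Real.coe_toNNReal _ hx', min_rpow_one hx' (show 0 < p by linarith)]
  have hF : MemLp (compNonneg H u) 2 (volume.restrict Ω) := by
    refine MemLp.of_bound ?_ ((p - 1) / (p * C)) ?_
    · refine AEStronglyMeasurable.congr ?_ hcomp.symm
      exact (((hu.1.1.aemeasurable.min aemeasurable_const).pow_const p).const_mul
        _).aestronglyMeasurable
    · refine Eventually.of_forall fun x => ?_
      simp only [compNonneg, hH]
      rw [Real.norm_of_nonneg (NNReal.coe_nonneg _), NNReal.coe_mul, hcv]
      refine mul_le_of_le_one_right hc.le ?_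
      exact_mod_cast min_le_right _ _
  refine ⟨hu0, isEnergyMinimizer_zeta hN hΩm hb hF, ?_⟩
  obtain ⟨w, k, hw⟩ := exists_isWeakSolution (V := V) hN hΩm hb hF
  filter_upwards [hw.zeta_ae_eq hN hΩm hb hF,
    hD.ae_le hN hΩm hb hV hC0 hC hu.1 hu0 hp (hw.congr_datum hcomp)] with x a b
  rwa [a]

end Main

theorem mainTheorem9 (N : ℕ) (hN : 1 ≤ N) (Ω : Set (EuclideanSpace ℝ (Fin N)))
    (hΩ : IsSmoothBoundedDomain Ω) :
    (∃ H : ℝ≥0 → ℝ≥0, Continuous H ∧ Monotone H ∧ (∃ M : ℝ≥0, ∀ t, H t ≤ M) ∧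
      (∀ t, 0 < t → 0 < H t) ∧ ComparisonHolds Ω H) ∧
    ∀ α : ℝ, 1 < α → ∃ c : ℝ≥0, 0 < c ∧
      ComparisonHolds Ω (fun t => c * min (t ^ α) 1) := by
  refine ⟨?_, fun α hα => exists_comparisonHolds hN hΩ.isOpen hΩ.isBounded hα⟩
  -- Any exponent larger than `1` would serve for the existence of `H`.
  obtain ⟨c, hc, h⟩ := exists_comparisonHolds hN hΩ.isOpen hΩ.isBounded (p := 2) one_lt_two
  refine ⟨_, ?_, ?_, ⟨c, fun t => ?_⟩, fun t ht => ?_, h⟩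
  · exact continuous_const.mul ((NNReal.continuous_rpow_const zero_le_two).min continuous_const)
  · intro s t hst
    dsimp only
    gcongr
  · exact mul_le_of_le_one_right zero_le (min_le_right _ _)
  · exact mul_pos hc (lt_min (NNReal.rpow_pos ht) one_pos)
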